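/- Fix $q\in(-1,1)$ and a finite Borel measure $\nu$ on $\mathbb R$ with compact support. Put $r_1=0$ and $r_{k+2}=\int x^k\,d\nu(x)$ for $k\ge 0$. Let $\mathcal H=L^2(\mathbb R_+,dt)\otimes L^2(\mathbb R,\nu)$, and let $\mathcal F_q(\mathcal H)$ be the $q$-Fock space of $\mathcal H$ with vacuum $\Omega$, that is, the completion of $\bigoplus_{n\ge0}\mathcal H^{\otimes n}$ for the $q$-inner product $$\langle \xi_1\otimes\dots\otimes\xi_n,\eta_1\otimes\dots\otimes\eta_m\rangle_q=\delta_{nm}\sum_{\sigma\in \mathrm{Sym}(n)}q^{i(\sigma)}\prod_{i=1}^n\langle\xi_i,\eta_{\sigma(i)}\rangle ,$$ where $i(\sigma)$ is the number of inversions of $\sigma$. For $\zeta\in\mathcal H$ and a bounded operator $T$ on $\mathcal H$ let $a^*(\zeta)(\eta_1\otimes\dots\otimes\eta_n)=\zeta\otimes\eta_1\otimes\dots\otimes\eta_n$, $a(\zeta)(\eta_1\otimes\dots\otimes\eta_n)=\sum_k q^{k-1}\langle\zeta,\eta_k\rangle\,\eta_1\otimes\dots\check\eta_k\dots\otimes\eta_n$,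 $p(T)(\eta_1\otimes\dots\otimes\eta_n)=\sum_k q^{k-1}(T\eta_k)\otimes\eta_1\otimes\dots\check\eta_k\dots\otimes\eta_n$ (where $\check\eta_k$ means that $\eta_k$ is omitted, and $a(\zeta)\Omega=p(T)\Omega=0$), and $p(\zeta,T)=a(\zeta)+a^*(\zeta)+p(T)$. For an interval $I=[a,b)\subset\mathbb R_+$ and $k\ge1$ put $$Y_k(I)=p\bigl(\chi_I\otimes x^{k-1},\ \text{multiplication by }\chi_I\otimes x^{k}\bigr),\qquad X(I)=Y_1(I),$$ so that $X$ is the (centered) $q$-Lévy process with canonical measure $\nu$. Let $\mathcal A_X$ be the complex algebra generated by all $X(I)$, and let $L^2(\mathcal A_X,\varphi)$ be its completion for $\langle A,B\rangle_\varphi=\langle A\Omega,B\Omega\rangle_q$, which is identified through $A\mapsto A\Omega$ with a closed subspace of $\mathcal F_q(\mathcal H)$. For $u(1),\dots,u(k)\ge1$, the multiple stochastic integral $\int F\,dY_{u(1)}\cdots dY_{u(k)}\in\mathcal F_q(\mathcal H)$, $F\in L^2(\mathbb R_+^k)$, is the extension by linearity and continuity of $\chi_{I_1\times\dots\times I_k}\mapsto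 Y_{u(1)}(I_1)\cdots Y_{u(k)}(I_k)\Omega$ for pairwise disjoint intervals $I_1,\dots,I_k$; and $\psi(Y_{u(1)}(t),\dots,Y_{u(k)}(t))$ is the integral of $F=\chi_{[0,t)^k}$. Let $\pi$ be a set partition of $\{1,\dots,n\}$ and $t\ge 0$. For a subdivision $\mathcal I=\{I_1,\dots,I_N\}$ of $[0,t)$ into intervals, with $\delta(\mathcal I)=\max_i|I_i|$, let $$\mathrm{St}_\pi(t;\mathcal I)=\sum_u X(I_{u(1)})\cdots X(I_{u(n)}),$$ the sum being over all $u:\{1,\dots,n\}\to\{1,\dots,N\}$ such that $u(i)=u(j)$ if and only if $i$ and $j$ lie in the same class of $\pi$. For $S\subset\pi$ let $\mathrm{rc}(S,\pi)=\sum_{k=1}^n\mathrm{rc}(k,S,\pi)$, where $\mathrm{rc}(k,S,\pi)=0$ if $k$ is the largest element of its class and otherwise, with $j$ the next larger element of the class of $k$, $\mathrm{rc}(k,S,\pi)$ is the number of classes $C\in\pi$ that meet $\{k+1,\dots,j-1\}$ and that belong to $S$ or meet $\{1,\dots,k\}$. Let $R_{\pi\setminus S}(t)=t^{|\pi\setminus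 S|}\prod_{B\in\pi\setminus S}r_{|B|}$. Then the full stochastic measures $\psi(Y_{|B|}(t):B\in S)$, $S\subset\pi$, where the classes $B\in S$ are ordered by their first elements, are well defined; the partition-dependent stochastic measure $\mathrm{St}_\pi(t)=\lim_{\delta(\mathcal I)\to0}\mathrm{St}_\pi(t;\mathcal I)$ exists as a (unique) limit in $L^2(\mathcal A_X,\varphi)$; and $$\mathrm{St}_\pi(t)=\sum_{S\subset\pi}q^{\mathrm{rc}(S,\pi)}\,R_{\pi\setminus S}(t)\,\psi(Y_{|B|}(t):B\in S).$$ -/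

import Mathlib

namespace QLevy

open MeasureTheory Filter Topology
open scoped TensorProduct ENNReal ComplexConjugate

noncomputable section

section Fock

variable {H : Type*} [NormedAddCommGroup H] [InnerProductSpace ℂ H]

/-- Number of inversions of a permutation. -/
def inversions {n : ℕ} (σ : Equiv.Perm (Fin n)) : ℕ :=
  (Finset.univ.filter fun p : Fin n × Fin n => p.1 < p.2 ∧ σ p.2 < σ p.1).card

/-- The functional `⟨ξ₁ ⊗ ⋯ ⊗ ξₙ, ·⟩₀` on the `n`-particle space. -/
def tprodInner {n : ℕ} (ξ : Fin n → H) : (⨂[ℂ]^n H) →ₗ[ℂ] ℂ :=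
  PiTensorProduct.lift
    ((MultilinearMap.mkPiAlgebra ℂ (Fin n) ℂ).compLinearMap fun i => innerₛₗ ℂ (ξ i))

theorem tprodInner_tprod {n : ℕ} (ξ η : Fin n → H) :
    tprodInner ξ (PiTensorProduct.tprod ℂ η) = ∏ i, inner ℂ (ξ i) (η i) := by
  simp [tprodInner]

theorem tprodInner_update_add {n : ℕ} (ξ : Fin n → H) (i : Fin n) (x y : H) :
    tprodInner (Function.update ξ i (x + y)) =
      tprodInner (Function.update ξ i x) + tprodInner (Function.update ξ i y) := by
  refine PiTensorProduct.ext (MultilinearMap.ext fun η => ?_)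
  simp only [LinearMap.compMultilinearMap_apply, LinearMap.add_apply, tprodInner_tprod]
  simp only [Fintype.prod_eq_mul_prod_compl i, Function.update_self, inner_add_left, add_mul]
  congr 2 <;>
  · refine Finset.prod_congr rfl fun j hj => ?_
    have : j ≠ i := by simpa using hj
    simp [Function.update_of_ne this]

theorem tprodInner_update_smul {n : ℕ} (ξ : Fin n → H) (i : Fin n) (c : ℂ) (x : H) :
    tprodInner (Function.update ξ i (c • x)) = conj c • tprodInner (Function.update ξ i x) := by
  refine PiTensorProduct.ext (MultilinearMap.ext fun η => ?_)
  simp only [LinearMap.compMultilinearMap_apply, LinearMap.smul_apply, tprodInner_tprod]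
  simp only [Fintype.prod_eq_mul_prod_compl i, Function.update_self, inner_smul_left, smul_eq_mul,
    mul_assoc]
  congr 2
  refine Finset.prod_congr rfl fun j hj => ?_
  have : j ≠ i := by simpa using hj
  simp [Function.update_of_ne this]

/-- The inner product `⟨v, w⟩₀` on the `n`-particle space, conjugate linear in `v`:
`⟨ξ₁ ⊗ ⋯ ⊗ ξₙ, η₁ ⊗ ⋯ ⊗ ηₙ⟩₀ = ∏ ⟨ξᵢ, ηᵢ⟩`. -/
def inner0 (n : ℕ) : (⨂[ℂ]^n H) →+ ((⨂[ℂ]^n H) →ₗ[ℂ] ℂ) :=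
  PiTensorProduct.liftAddHom (fun p => conj p.1 • tprodInner p.2)
    (by
      intro r f i hi
      have h := tprodInner_update_smul f i 0 (f i)
      have h2 : tprodInner f = 0 := by
        rw [← Function.update_eq_self i f, hi]
        simpa [hi] using h
      simp [h2])
    (by intro f; simp)
    (by
      intro inst r f i x y
      obtain rfl : inst = instDecidableEqFin n := Subsingleton.elim _ _
      have h := tprodInner_update_add f i x y
      simp only [h, smul_add])
    (by intro r r' f; simp [add_smul])
    (by
      intro inst r f i r'
      obtain rfl : inst = instDecidableEqFin n := Subsingleton.elim _ _
      have h := tprodInner_update_smul f i r' (f i)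
      rw [Function.update_eq_self] at h
      simp only [h, smul_smul, map_mul, mul_comm])

theorem inner0_smul_tprod {n : ℕ} (c : ℂ) (ξ : Fin n → H) :
    inner0 n (c • PiTensorProduct.tprod ℂ ξ) = conj c • tprodInner ξ := by
  rw [← PiTensorProduct.tprodCoeff_eq_smul_tprod]
  rfl

theorem inner0_tprod_tprod {n : ℕ} (ξ η : Fin n → H) :
    inner0 n (PiTensorProduct.tprod ℂ ξ) (PiTensorProduct.tprod ℂ η) =
      ∏ i, inner ℂ (ξ i) (η i) := by
  have h := inner0_smul_tprod 1 ξ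
  rw [one_smul] at h
  rw [h, map_one, one_smul, tprodInner_tprod]

theorem inner0_smul {n : ℕ} (c : ℂ) (v : ⨂[ℂ]^n H) : inner0 n (c • v) = conj c • inner0 n v := by
  induction v using PiTensorProduct.induction_on with
  | smul_tprod r f => rw [smul_smul, inner0_smul_tprod, inner0_smul_tprod, map_mul, smul_smul]
  | add x y hx hy => rw [smul_add, map_add, map_add, hx, hy, smul_add]

/-- The operator `Pₙ (ξ₁ ⊗ ⋯ ⊗ ξₙ) = ∑_σ q^{i(σ)} ξ_{σ(1)} ⊗ ⋯ ⊗ ξ_{σ(n)}`. -/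
def qSym (q : ℝ) (n : ℕ) : (⨂[ℂ]^n H) →ₗ[ℂ] (⨂[ℂ]^n H) :=
  ∑ σ : Equiv.Perm (Fin n), ((q : ℂ) ^ inversions σ) •
    (PiTensorProduct.reindex ℂ (fun _ : Fin n => H) σ.symm).toLinearMap

theorem qSym_tprod (q : ℝ) {n : ℕ} (ξ : Fin n → H) :
    qSym q n (PiTensorProduct.tprod ℂ ξ) =
      ∑ σ : Equiv.Perm (Fin n), ((q : ℂ) ^ inversions σ) •
        PiTensorProduct.tprod ℂ (fun i => ξ (σ i)) := by
  simp only [qSym, LinearMap.sum_apply, LinearMap.smul_apply, LinearEquiv.coe_coe]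
  refine Finset.sum_congr rfl fun σ _ => ?_
  rw [PiTensorProduct.reindex_tprod]
  rfl

theorem inner0_qSym_tprod (q : ℝ) {n : ℕ} (ξ η : Fin n → H) :
    inner0 n (PiTensorProduct.tprod ℂ ξ) (qSym q n (PiTensorProduct.tprod ℂ η)) =
      ∑ σ : Equiv.Perm (Fin n), (q : ℂ) ^ inversions σ * ∏ i, inner ℂ (ξ i) (η (σ i)) := by
  simp [qSym_tprod, inner0_tprod_tprod]

theorem inversions_symm {n : ℕ} (σ : Equiv.Perm (Fin n)) : inversions σ.symm = inversions σ := by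
  unfold inversions
  refine Finset.card_bij' (fun p _ => (σ.symm p.2, σ.symm p.1)) (fun p _ => (σ p.2, σ p.1))
    ?_ ?_ ?_ ?_ <;> simp <;> tauto

theorem inner0_qSym_symm (q : ℝ) {n : ℕ} (v w : ⨂[ℂ]^n H) :
    conj (inner0 n w (qSym q n v)) = inner0 n v (qSym q n w) := by
  induction v using PiTensorProduct.induction_on with
  | add x y hx hy => simp only [map_add, LinearMap.add_apply, hx, hy]
  | smul_tprod r f =>
    induction w using PiTensorProduct.induction_on with
    | add x y hx hy => simp only [map_add, LinearMap.add_apply, hx, hy]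
    | smul_tprod s g =>
      simp only [map_smul, inner0_smul, LinearMap.smul_apply, inner0_qSym_tprod, smul_eq_mul,
        map_mul, map_sum, map_pow, map_prod, Complex.conj_ofReal, inner_conj_symm,
        Complex.conj_conj]
      have : ∑ σ : Equiv.Perm (Fin n), (q : ℂ) ^ inversions σ * ∏ i, inner ℂ (f (σ i)) (g i) =
          ∑ σ : Equiv.Perm (Fin n), (q : ℂ) ^ inversions σ * ∏ i, inner ℂ (f i) (g (σ i)) := by
        refine Fintype.sum_equiv (Equiv.inv _) _ _ fun σ => ?_
        change _ = (q : ℂ) ^ inversions σ.symm * ∏ i, inner ℂ (f i) (g (σ.symm i))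
        rw [inversions_symm]
        congr 1
        refine Fintype.prod_equiv σ _ _ fun i => ?_
        rw [Equiv.symm_apply_apply]
      rw [this]
      ring

/-! Positivity of the `q`-inner product. -/

section Positivity

open scoped ComplexOrder Matrix

theorem posSemidef_prod {ι κ : Type*} [Finite κ] (s : Finset ι) (M : ι → Matrix κ κ ℂ)
    (h : ∀ i ∈ s, (M i).PosSemidef) :
    (Matrix.of fun a b => ∏ i ∈ s, M i a b).PosSemidef := by
  classical
  induction s using Finset.induction_on with
  | empty =>
    have := Matrix.posSemidef_vecMulVec_self_star (fun _ : κ => (1 : ℂ))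
    convert this using 1
    ext a b
    simp [Matrix.vecMulVec_apply]
  | insert i s hi ih =>
    have e : (Matrix.of fun a b => ∏ i ∈ insert i s, M i a b) =
        (M i).hadamard (Matrix.of fun a b => ∏ i ∈ s, M i a b) := by
      ext a b
      simp [Finset.prod_insert hi, Matrix.hadamard_apply]
    rw [e]
    exact (h i (Finset.mem_insert_self i s)).hadamard
      (ih fun j hj => h j (Finset.mem_insert_of_mem hj))

theorem posSemidef_agree {q : ℝ} (hq : q ∈ Set.Ioo (-1 : ℝ) 1) {κ : Type*} [Finite κ]
    (p : κ → Prop) [DecidablePred p] :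
    (Matrix.of fun a b => if (p a ↔ p b) then (1 : ℂ) else (q : ℂ)).PosSemidef := by
  have hs : (0 : ℝ) ≤ 1 - q ^ 2 := by nlinarith [hq.1, hq.2]
  have h1 := Matrix.posSemidef_vecMulVec_self_star (fun a : κ => if p a then (1 : ℂ) else q)
  have h2 := Matrix.posSemidef_vecMulVec_self_star
    (fun a : κ => if p a then (0 : ℂ) else (Real.sqrt (1 - q ^ 2) : ℂ))
  have hsq : (Real.sqrt (1 - q ^ 2) : ℂ) * (Real.sqrt (1 - q ^ 2) : ℂ) = 1 - (q : ℂ) ^ 2 := by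
    rw [← Complex.ofReal_mul, Real.mul_self_sqrt hs]
    push_cast
    ring
  convert h1.add h2 using 1
  ext a b
  by_cases ha : p a <;> by_cases hb : p b <;> simp [ha, hb, Matrix.vecMulVec_apply, hsq]
  ring

theorem inversions_trans {n : ℕ} (τ ρ : Equiv.Perm (Fin n)) :
    inversions (τ.symm.trans ρ) =
      ((Finset.univ.filter fun p : Fin n × Fin n => p.1 < p.2).filter
        fun p => ¬ (τ p.1 < τ p.2 ↔ ρ p.1 < ρ p.2)).card := by
  unfold inversions
  rw [Finset.filter_filter]
  refine Finset.card_bij'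
    (fun p _ => if τ.symm p.1 < τ.symm p.2 then (τ.symm p.1, τ.symm p.2)
      else (τ.symm p.2, τ.symm p.1))
    (fun p _ => if τ p.1 < τ p.2 then (τ p.1, τ p.2) else (τ p.2, τ p.1)) ?_ ?_ ?_ ?_
  · rintro ⟨x, y⟩ h
    obtain ⟨a, rfl⟩ := τ.surjective x
    obtain ⟨b, rfl⟩ := τ.surjective y
    simp only [Finset.mem_filter, Finset.mem_univ, true_and, Equiv.trans_apply,
      Equiv.symm_apply_apply] at h ⊢
    split_ifs with h' <;> grind
  · rintro ⟨x, y⟩ h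
    have hne : ρ x = ρ y → x = y := fun e => ρ.injective e
    have hne' : τ x = τ y → x = y := fun e => τ.injective e
    simp only [Finset.mem_filter, Finset.mem_univ, true_and] at h
    refine Finset.mem_filter.2 ⟨Finset.mem_univ _, ?_⟩
    simp only [Equiv.trans_apply]
    split_ifs with h' <;> simp only [Equiv.symm_apply_apply] <;> grind
  · rintro ⟨x, y⟩ h
    obtain ⟨a, rfl⟩ := τ.surjective x
    obtain ⟨b, rfl⟩ := τ.surjective y
    replace h := (Finset.mem_filter.1 h).2
    simp only [Equiv.trans_apply, Equiv.symm_apply_apply] at h ⊢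
    split_ifs with h' <;> grind
  · rintro ⟨x, y⟩ h
    simp only [Finset.mem_filter, Finset.mem_univ, true_and] at h
    split_ifs with h' <;> simp only [Equiv.symm_apply_apply] <;> grind

theorem posSemidef_inversions {q : ℝ} (hq : q ∈ Set.Ioo (-1 : ℝ) 1) (n : ℕ) :
    (Matrix.of fun τ ρ : Equiv.Perm (Fin n) =>
      (q : ℂ) ^ inversions (τ.symm.trans ρ)).PosSemidef := by
  have h := posSemidef_prod (Finset.univ.filter fun p : Fin n × Fin n => p.1 < p.2)
    (fun p => Matrix.of fun τ ρ : Equiv.Perm (Fin n) =>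
      if (τ p.1 < τ p.2 ↔ ρ p.1 < ρ p.2) then (1 : ℂ) else (q : ℂ))
    fun p _ => posSemidef_agree hq fun τ : Equiv.Perm (Fin n) => τ p.1 < τ p.2
  convert h using 1
  ext τ ρ
  simp only [Matrix.of_apply]
  rw [inversions_trans, Finset.prod_ite]
  simp

theorem exists_sum_tprod {n : ℕ} (v : ⨂[ℂ]^n H) :
    ∃ (m : ℕ) (c : Fin m → ℂ) (f : Fin m → Fin n → H),
      v = ∑ j, c j • PiTensorProduct.tprod ℂ (f j) := by
  induction v using PiTensorProduct.induction_on with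
  | smul_tprod r f => exact ⟨1, fun _ => r, fun _ => f, by simp⟩
  | add x y hx hy =>
    obtain ⟨m, c, f, rfl⟩ := hx
    obtain ⟨m', c', f', rfl⟩ := hy
    exact ⟨m + m', Fin.append c c', Fin.append f f', by simp [Fin.sum_univ_add]⟩

theorem inner0_qSym_nonneg {q : ℝ} (hq : q ∈ Set.Ioo (-1 : ℝ) 1) {n : ℕ} (v : ⨂[ℂ]^n H) :
    0 ≤ inner0 n v (qSym q n v) := by
  obtain ⟨m, c, f, rfl⟩ := exists_sum_tprod v
  have hM : (Matrix.of fun a b : Fin m × Equiv.Perm (Fin n) =>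
      (q : ℂ) ^ inversions (a.2.symm.trans b.2) *
        ∏ i, inner ℂ (f a.1 (a.2 i)) (f b.1 (b.2 i))).PosSemidef := by
    have h1 := (posSemidef_inversions hq n).submatrix
      (fun a : Fin m × Equiv.Perm (Fin n) => a.2)
    have h2 := posSemidef_prod (Finset.univ : Finset (Fin n))
      (fun i => Matrix.gram ℂ fun a : Fin m × Equiv.Perm (Fin n) => f a.1 (a.2 i))
      fun i _ => Matrix.posSemidef_gram ℂ _
    exact h1.hadamard h2
  have h := hM.dotProduct_mulVec_nonneg fun a => c a.1
  have key : star (fun a : Fin m × Equiv.Perm (Fin n) => c a.1) ⬝ᵥ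
      ((Matrix.of fun a b : Fin m × Equiv.Perm (Fin n) =>
        (q : ℂ) ^ inversions (a.2.symm.trans b.2) *
          ∏ i, inner ℂ (f a.1 (a.2 i)) (f b.1 (b.2 i))) *ᵥ fun a => c a.1) =
      (n.factorial : ℂ) * inner0 n (∑ j, c j • PiTensorProduct.tprod ℂ (f j))
        (qSym q n (∑ j, c j • PiTensorProduct.tprod ℂ (f j))) := by
    have hτ : ∀ (j k : Fin m) (τ : Equiv.Perm (Fin n)),
        ∑ ρ : Equiv.Perm (Fin n), (q : ℂ) ^ inversions (τ.symm.trans ρ) *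
          ∏ i, inner ℂ (f j (τ i)) (f k (ρ i)) =
        ∑ σ : Equiv.Perm (Fin n), (q : ℂ) ^ inversions σ * ∏ i, inner ℂ (f j i) (f k (σ i)) := by
      intro j k τ
      refine Fintype.sum_equiv (Equiv.mulRight τ⁻¹) _ _ fun ρ => ?_
      change _ = (q : ℂ) ^ inversions (τ.symm.trans ρ) *
        ∏ i, inner ℂ (f j i) (f k (ρ (τ.symm i)))
      congr 1
      refine Fintype.prod_equiv τ _ _ fun i => ?_
      simp
    simp only [map_sum, map_smul, inner0_smul, LinearMap.smul_apply,
      LinearMap.sum_apply, inner0_qSym_tprod, smul_eq_mul, dotProduct, Matrix.mulVec,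
      Fintype.sum_prod_type, Matrix.of_apply, Pi.star_apply]
    have : ∀ (j : Fin m) (τ : Equiv.Perm (Fin n)),
        ∑ k, ∑ ρ : Equiv.Perm (Fin n), (q : ℂ) ^ inversions (τ.symm.trans ρ) *
          (∏ i, inner ℂ (f j (τ i)) (f k (ρ i))) * c k =
        ∑ k, c k * ∑ σ : Equiv.Perm (Fin n), (q : ℂ) ^ inversions σ *
          ∏ i, inner ℂ (f j i) (f k (σ i)) := by
      intro j τ
      refine Finset.sum_congr rfl fun k _ => ?_
      rw [← Finset.sum_mul, hτ, mul_comm]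
    simp only [this, Finset.sum_const, Finset.card_univ, Fintype.card_perm, Fintype.card_fin,
      nsmul_eq_mul, Finset.mul_sum]
    rw [Finset.sum_comm]
    refine Finset.sum_congr rfl fun j _ => Finset.sum_congr rfl fun k _ =>
      Finset.sum_congr rfl fun l _ => ?_
    simp only [RCLike.star_def]
    ring
  rw [key] at h
  have hn : (0 : ℂ) < (n.factorial : ℂ) := by exact_mod_cast n.factorial_pos
  have h' := mul_nonneg (inv_pos.2 hn).le h
  rwa [inv_mul_cancel_left₀ hn.ne'] at h'

end Positivity

/-! The `q`-Fock space. -/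

/-- The algebraic Fock space `⨁ₙ H^{⊗n}`, to be equipped with the `q`-inner product. -/
def FockAlg (_q : Set.Ioo (-1 : ℝ) 1) (H : Type*) [NormedAddCommGroup H]
    [InnerProductSpace ℂ H] : Type _ :=
  DirectSum ℕ fun n => ⨂[ℂ]^n H

instance (q : Set.Ioo (-1 : ℝ) 1) : AddCommGroup (FockAlg q H) :=
  inferInstanceAs (AddCommGroup (DirectSum ℕ fun n => ⨂[ℂ]^n H))

instance (q : Set.Ioo (-1 : ℝ) 1) : Module ℂ (FockAlg q H) :=
  inferInstanceAs (Module ℂ (DirectSum ℕ fun n => ⨂[ℂ]^n H))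

/-- The `n`-particle component of a vector of the algebraic Fock space. -/
def FockAlg.component {q : Set.Ioo (-1 : ℝ) 1} (n : ℕ) : FockAlg q H →ₗ[ℂ] (⨂[ℂ]^n H) :=
  DirectSum.component ℂ ℕ (fun n => ⨂[ℂ]^n H) n

/-- The inclusion of the `n`-particle space in the algebraic Fock space. -/
def FockAlg.incl (q : Set.Ioo (-1 : ℝ) 1) (n : ℕ) : (⨂[ℂ]^n H) →ₗ[ℂ] FockAlg q H :=
  DirectSum.lof ℂ ℕ (fun n => ⨂[ℂ]^n H) n

theorem FockAlg.finite_component {q : Set.Ioo (-1 : ℝ) 1} (v : FockAlg q H) :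
    {n | FockAlg.component n v ≠ 0}.Finite := by
  classical
  refine (DFinsupp.support (β := fun n => ⨂[ℂ]^n H) v).finite_toSet.subset fun n hn => ?_
  exact Finset.mem_coe.2 (DFinsupp.mem_support_iff.2 hn)

/-- The `q`-inner product `⟨v, w⟩_q = ⟨v, P w⟩₀`; different particle numbers are orthogonal. -/
def innerQ {q : Set.Ioo (-1 : ℝ) 1} (v w : FockAlg q H) : ℂ :=
  ∑ᶠ n : ℕ, inner0 n (FockAlg.component n v) (qSym q n (FockAlg.component n w))

theorem innerQ_finite {q : Set.Ioo (-1 : ℝ) 1} (v w : FockAlg q H) :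
    (Function.support fun n : ℕ =>
      inner0 n (FockAlg.component n v) (qSym q n (FockAlg.component n w))).Finite := by
  refine (FockAlg.finite_component v).subset fun n hn hv => hn ?_
  simp [hv]

open scoped ComplexOrder in
/-- The `q`-inner product is sesquilinear, Hermitian and positive. -/
@[reducible]
def fockCore (q : Set.Ioo (-1 : ℝ) 1) (H : Type*) [NormedAddCommGroup H]
    [InnerProductSpace ℂ H] : PreInnerProductSpace.Core ℂ (FockAlg q H) where
  inner v w := innerQ v w
  conj_inner_symm v w := by
    simp only [innerQ]
    refine ((starRingEnd ℂ).toAddMonoidHom.map_finsum (innerQ_finite w v)).trans ?_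
    exact finsum_congr fun n => inner0_qSym_symm _ _ _
  re_inner_nonneg v := by
    have h : 0 ≤ innerQ v v := finsum_induction (fun z : ℂ => 0 ≤ z) le_rfl
      (fun _ _ hx hy => add_nonneg hx hy) fun n => inner0_qSym_nonneg q.2 _
    exact (Complex.nonneg_iff.1 h).1
  add_left u v w := by
    simp only [innerQ, map_add, LinearMap.add_apply]
    exact finsum_add_distrib (innerQ_finite u w) (innerQ_finite v w)
  smul_left u v r := by
    simp only [innerQ, map_smul, inner0_smul, LinearMap.smul_apply]
    exact (smul_finsum' _ (innerQ_finite u v)).symm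

instance (q : Set.Ioo (-1 : ℝ) 1) : SeminormedAddCommGroup (FockAlg q H) :=
  InnerProductSpace.Core.toSeminormedAddCommGroup (c := fockCore q H)

instance (q : Set.Ioo (-1 : ℝ) 1) : InnerProductSpace ℂ (FockAlg q H) :=
  InnerProductSpace.ofCore (fockCore q H)

/-- The `q`-Fock space: the Hilbert space completion of the algebraic Fock space with respect to
the `q`-inner product. -/
abbrev FockSpace (q : Set.Ioo (-1 : ℝ) 1) (H : Type*) [NormedAddCommGroup H]
    [InnerProductSpace ℂ H] : Type _ :=
  UniformSpace.Completion (FockAlg q H)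

/-- The vacuum vector `Ω`. -/
def vacuum (q : Set.Ioo (-1 : ℝ) 1) (H : Type*) [NormedAddCommGroup H]
    [InnerProductSpace ℂ H] : FockAlg q H :=
  FockAlg.incl q 0 (PiTensorProduct.tprod ℂ Fin.elim0)

/-- `ζ ⊗ η₁ ⊗ ⋯ ⊗ ηₙ` as a function of `η₁ ⊗ ⋯ ⊗ ηₙ`. -/
def creationN (n : ℕ) (ζ : H) : (⨂[ℂ]^n H) →ₗ[ℂ] (⨂[ℂ]^(n + 1) H) :=
  PiTensorProduct.lift ((PiTensorProduct.tprod ℂ (s := fun _ : Fin (n + 1) => H)).curryLeft ζ)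

theorem creationN_tprod (n : ℕ) (ζ : H) (η : Fin n → H) :
    creationN n ζ (PiTensorProduct.tprod ℂ η) =
      PiTensorProduct.tprod ℂ (Fin.cons ζ η : Fin (n + 1) → H) := by
  simp [creationN]

/-- `∑ₖ q^{k-1} ⟨ζ, ηₖ⟩ η₁ ⊗ ⋯ ⊗ (omit ηₖ) ⊗ ⋯ ⊗ ηₙ₊₁`. -/
def annihilationN (q : ℝ) (n : ℕ) (ζ : H) : (⨂[ℂ]^(n + 1) H) →ₗ[ℂ] (⨂[ℂ]^n H) :=
  PiTensorProduct.lift (∑ k : Fin (n + 1), ((q : ℂ) ^ (k : ℕ)) •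
    LinearMap.uncurryMid k (LinearMap.smulRight (innerₛₗ ℂ ζ)
      (PiTensorProduct.tprod ℂ (s := fun _ : Fin n => H))))

theorem annihilationN_tprod (q : ℝ) (n : ℕ) (ζ : H) (η : Fin (n + 1) → H) :
    annihilationN q n ζ (PiTensorProduct.tprod ℂ η) =
      ∑ k : Fin (n + 1), ((q : ℂ) ^ (k : ℕ) * inner ℂ ζ (η k)) •
        PiTensorProduct.tprod ℂ (k.removeNth η) := by
  simp [annihilationN, smul_smul]

/-- `∑ₖ q^{k-1} (T ηₖ) ⊗ η₁ ⊗ ⋯ ⊗ (omit ηₖ) ⊗ ⋯ ⊗ ηₙ₊₁`. -/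
def gaugeN (q : ℝ) (n : ℕ) (T : H →L[ℂ] H) : (⨂[ℂ]^(n + 1) H) →ₗ[ℂ] (⨂[ℂ]^(n + 1) H) :=
  PiTensorProduct.lift (∑ k : Fin (n + 1), ((q : ℂ) ^ (k : ℕ)) •
    LinearMap.uncurryMid k
      ((PiTensorProduct.tprod ℂ (s := fun _ : Fin (n + 1) => H)).curryLeft ∘ₗ T.toLinearMap))

theorem gaugeN_tprod (q : ℝ) (n : ℕ) (T : H →L[ℂ] H) (η : Fin (n + 1) → H) :
    gaugeN q n T (PiTensorProduct.tprod ℂ η) =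
      ∑ k : Fin (n + 1), ((q : ℂ) ^ (k : ℕ)) •
        PiTensorProduct.tprod ℂ (Fin.cons (T (η k)) (k.removeNth η) : Fin (n + 1) → H) := by
  simp [gaugeN]

/-- The creation operator `a*(ζ)` on the algebraic Fock space. -/
def creation (q : Set.Ioo (-1 : ℝ) 1) (ζ : H) : Module.End ℂ (FockAlg q H) :=
  DirectSum.toModule ℂ ℕ (FockAlg q H) fun n => FockAlg.incl q (n + 1) ∘ₗ creationN n ζ

/-- The annihilation operator `a(ζ)` on the algebraic Fock space. -/
def annihilation (q : Set.Ioo (-1 : ℝ) 1) (ζ : H) : Module.End ℂ (FockAlg q H) :=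
  DirectSum.toModule ℂ ℕ (FockAlg q H) fun
    | 0 => 0
    | n + 1 => FockAlg.incl q n ∘ₗ annihilationN q n ζ

/-- The gauge operator `p(T)` on the algebraic Fock space. -/
def gauge (q : Set.Ioo (-1 : ℝ) 1) (T : H →L[ℂ] H) : Module.End ℂ (FockAlg q H) :=
  DirectSum.toModule ℂ ℕ (FockAlg q H) fun
    | 0 => 0
    | n + 1 => FockAlg.incl q (n + 1) ∘ₗ gaugeN q n T

/-- `p(ζ, T) = a(ζ) + a*(ζ) + p(T)`. -/
def fieldOp (q : Set.Ioo (-1 : ℝ) 1) (ζ : H) (T : H →L[ℂ] H) : Module.End ℂ (FockAlg q H) :=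
  annihilation q ζ + creation q ζ + gauge q T

end Fock

/-! The centered `q`-Lévy process with canonical measure `ν`. -/

section Levy

/-- The measure `dt ⊗ ν` on `ℝ₊ × ℝ`. -/
def baseMeasure (ν : Measure ℝ) : Measure (ℝ × ℝ) :=
  (volume.restrict (Set.Ici 0)).prod ν

/-- The one-particle space `L²(ℝ₊, dt) ⊗ L²(ℝ, ν) = L²(ℝ₊ × ℝ, dt ⊗ ν)`. -/
abbrev OneParticle (ν : Measure ℝ) : Type :=
  Lp ℂ 2 (baseMeasure ν)

/-- The function `χ_{[a, b)} ⊗ xᵏ` on `ℝ₊ × ℝ`. -/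
def incrFun (k : ℕ) (a b : ℝ) (z : ℝ × ℝ) : ℂ :=
  (Set.Ico a b).indicator (fun _ => (z.2 : ℂ) ^ k) z.1

theorem measurable_incrFun (k : ℕ) (a b : ℝ) : Measurable (incrFun k a b) := by
  have : incrFun k a b =
      (Prod.fst ⁻¹' Set.Ico a b).indicator fun z : ℝ × ℝ => (z.2 : ℂ) ^ k := by
    ext z
    simp [incrFun, Set.indicator]
  rw [this]
  exact Measurable.indicator (by fun_prop) (measurable_fst measurableSet_Ico)

theorem memLp_top_incrFun (ν : Measure ℝ) [IsFiniteMeasure ν] (hν : IsCompact ν.support)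
    (k : ℕ) (a b : ℝ) : MemLp (incrFun k a b) ∞ (baseMeasure ν) := by
  obtain ⟨C, hC⟩ := hν.isBounded.exists_norm_le
  have hae : ∀ᵐ z ∂(baseMeasure ν), z.2 ∈ ν.support :=
    Measure.quasiMeasurePreserving_snd.ae Measure.support_mem_ae
  refine memLp_top_of_bound (measurable_incrFun k a b).aestronglyMeasurable (|C| ^ k) ?_
  filter_upwards [hae] with z hz
  have h1 : ‖z.2‖ ≤ |C| := (hC _ hz).trans (le_abs_self C)
  by_cases h : z.1 ∈ Set.Ico a b
  · simp only [incrFun, Set.indicator_of_mem h, norm_pow, Complex.norm_real]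
    gcongr
  · simp only [incrFun, Set.indicator_of_notMem h, norm_zero]
    positivity

theorem memLp_two_incrFun (ν : Measure ℝ) [IsFiniteMeasure ν] (hν : IsCompact ν.support)
    (k : ℕ) (a b : ℝ) : MemLp (incrFun k a b) 2 (baseMeasure ν) := by
  refine (memLp_top_incrFun ν hν k a b).mono_exponent_of_measure_support_ne_top
    (s := Set.Ico a b ×ˢ Set.univ) (fun z hz => ?_) ?_ le_top
  · have : z.1 ∉ Set.Ico a b := fun h => hz ⟨h, Set.mem_univ _⟩
    simp [incrFun, Set.indicator_of_notMem this]
  · rw [baseMeasure, Measure.prod_prod]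
    refine ENNReal.mul_ne_top ?_ (measure_ne_top _ _)
    exact ((Measure.restrict_apply_le _ _).trans_lt measure_Ico_lt_top).ne

/-- The vector `χ_{[a, b)} ⊗ xᵏ` of the one-particle space. -/
def incrVec (ν : Measure ℝ) [IsFiniteMeasure ν] (hν : IsCompact ν.support)
    (k : ℕ) (a b : ℝ) : OneParticle ν :=
  (memLp_two_incrFun ν hν k a b).toLp

/-- The bounded operator of multiplication by `χ_{[a, b)} ⊗ xᵏ` on the one-particle space. -/
def incrOp (ν : Measure ℝ) [IsFiniteMeasure ν] (hν : IsCompact ν.support)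
    (k : ℕ) (a b : ℝ) : OneParticle ν →L[ℂ] OneParticle ν :=
  (ContinuousLinearMap.mul ℂ ℂ).holderL (baseMeasure ν) ∞ 2 2
    (memLp_top_incrFun ν hν k a b).toLp

variable (q : Set.Ioo (-1 : ℝ) 1) (ν : Measure ℝ) [IsFiniteMeasure ν] (hν : IsCompact ν.support)

/-- For `k ≥ 1`, the increment `Y_k([a, b)) = p(χ_{[a, b)} ⊗ x^{k-1}, χ_{[a, b)} ⊗ xᵏ)` of the
process `Y_k`. -/
def levyY (k : ℕ) (a b : ℝ) : Module.End ℂ (FockAlg q (OneParticle ν)) :=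
  fieldOp q (incrVec ν hν (k - 1) a b) (incrOp ν hν k a b)

/-- The increment `X([a, b))` of the `q`-Lévy process `X = Y₁`. -/
def levyX (a b : ℝ) : Module.End ℂ (FockAlg q (OneParticle ν)) :=
  levyY q ν hν 1 a b

/-- The complex algebra generated by the operators `X([a, b))`. -/
def levyAlg : Subalgebra ℂ (Module.End ℂ (FockAlg q (OneParticle ν))) :=
  Algebra.adjoin ℂ {A | ∃ a b : ℝ, 0 ≤ a ∧ a < b ∧ A = levyX q ν hν a b}

/-- The map `A ↦ A Ω` into the `q`-Fock space, which is isometric for the norm of the inner product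
`⟨A, B⟩_φ = φ(A* B) = ⟨A Ω, B Ω⟩_q` of the vacuum state `φ`. -/
def applyVacuum : Module.End ℂ (FockAlg q (OneParticle ν)) →ₗ[ℂ] FockSpace q (OneParticle ν) :=
  (UniformSpace.Completion.toComplₗᵢ (𝕜 := ℂ) (E := FockAlg q (OneParticle ν))).toLinearMap ∘ₗ
    LinearMap.applyₗ (vacuum q (OneParticle ν))

/-- `L²(A_X, φ)`, the completion of the algebra generated by the `X([a, b))` for the inner product
`⟨·, ·⟩_φ`, realized through the isometry `A ↦ A Ω` as a closed subspace of the `q`-Fock space. -/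
def levyL2 : Submodule ℂ (FockSpace q (OneParticle ν)) :=
  ((Subalgebra.toSubmodule (levyAlg q ν hν)).map (applyVacuum q ν)).topologicalClosure

/-- `r_{k+2} = ∫ xᵏ dν`, and `r₁ = 0` (the value at `0` plays no role). -/
def levyMoment (ν : Measure ℝ) : ℕ → ℝ
  | 0 => 0
  | 1 => 0
  | k + 2 => ∫ x, x ^ k ∂ν

end Levy

/-! Multiple stochastic integrals. -/

section Integral

/-- The space `L²(ℝ₊ᵏ, dt^{⊗k})`. -/
abbrev L2Box (k : ℕ) : Type :=
  Lp ℂ 2 (Measure.pi fun _ : Fin k => (volume : Measure ℝ).restrict (Set.Ici 0))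

theorem measure_box_ne_top {k : ℕ} (a b : Fin k → ℝ) :
    (Measure.pi fun _ : Fin k => (volume : Measure ℝ).restrict (Set.Ici 0))
      (Set.univ.pi fun i => Set.Ico (a i) (b i)) ≠ ∞ := by
  rw [Measure.pi_pi]
  exact ENNReal.prod_ne_top fun i _ =>
    ((Measure.restrict_apply_le _ _).trans_lt measure_Ico_lt_top).ne

/-- The indicator function of `[a₁, b₁) × ⋯ × [aₖ, bₖ)`. -/
def boxIndicator {k : ℕ} (a b : Fin k → ℝ) : L2Box k :=
  indicatorConstLp 2 (MeasurableSet.univ_pi fun _ => measurableSet_Ico) (measure_box_ne_top a b) 1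

variable (q : Set.Ioo (-1 : ℝ) 1) (ν : Measure ℝ) [IsFiniteMeasure ν] (hν : IsCompact ν.support)

/-- The graph of the extension by linearity and continuity of the map
`χ_{I₁ × ⋯ × Iₖ} ↦ Y_{u(1)}(I₁) ⋯ Y_{u(k)}(Iₖ)`, for disjoint intervals `I₁, …, Iₖ`. -/
def integralGraph {k : ℕ} (u : Fin k → ℕ) : Submodule ℂ (L2Box k × FockSpace q (OneParticle ν)) :=
  (Submodule.span ℂ {p | ∃ a b : Fin k → ℝ, (∀ i, 0 ≤ a i ∧ a i < b i) ∧
    (∀ i j, i ≠ j → Disjoint (Set.Ico (a i) (b i)) (Set.Ico (a j) (b j))) ∧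
    p = (boxIndicator a b,
      applyVacuum q ν (List.ofFn fun i => levyY q ν hν (u i) (a i) (b i)).prod)}).topologicalClosure

/-- `v` is the multiple stochastic integral `∫ F dY_{u(1)} ⋯ dY_{u(k)}`. -/
def IsMultipleIntegral {k : ℕ} (u : Fin k → ℕ) (F : L2Box k)
    (v : FockSpace q (OneParticle ν)) : Prop :=
  (F, v) ∈ integralGraph q ν hν u

open Classical in
/-- The multiple stochastic integral `∫ F dY_{u(1)} ⋯ dY_{u(k)}` (zero if there is none). -/
def multipleIntegral {k : ℕ} (u : Fin k → ℕ) (F : L2Box k) : FockSpace q (OneParticle ν) :=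
  if h : ∃ v, IsMultipleIntegral q ν hν u F v then h.choose else 0

/-- The full stochastic measure `ψ(Y_{u(1)}, …, Y_{u(k)}; t)`, the integral of `χ_{[0, t)^k}`. -/
def fullMeasure {k : ℕ} (u : Fin k → ℕ) (t : ℝ) : FockSpace q (OneParticle ν) :=
  multipleIntegral q ν hν u (boxIndicator (fun _ => 0) fun _ => t)

end Integral

/-! Set partitions and extended partitions `(S, π)` of a set of `n` elements. -/

section Partitions

/-- Set partitions of a set of `n` elements. -/
abbrev SetPartition (n : ℕ) : Type :=
  Finpartition (Finset.univ : Finset (Fin n))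

variable {n : ℕ} (S : Finset (Finset (Fin n))) (π : SetPartition n)

/-- The classes which are open on the left in the restriction of the extended partition `(S, π)` to
the elements strictly between `k` and `j`: the nonempty traces of the classes which belong to `S`
or contain an element to the left of this interval. -/
def leftOpenBetween (k j : Fin n) : Finset (Finset (Fin n)) :=
  ((π.parts.filter fun C => C ∈ S ∨ ∃ i ∈ C, i ≤ k).image
    fun C => C ∩ Finset.Ioo k j).erase ∅

/-- The number of right restricted crossings of `(S, π)` at the point `k`. -/
def rcAt (k : Fin n) : ℕ :=
  if h : ((π.part k).filter fun i => k < i).Nonempty then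
    (leftOpenBetween S π k (((π.part k).filter fun i => k < i).min' h)).card
  else 0

/-- The number of restricted crossings of `(S, π)`. -/
def rc : ℕ :=
  ∑ k, rcAt S π k

/-- The first elements of the classes which belong to `S`. -/
def openMinima : Finset (Fin n) :=
  Finset.univ.filter fun m => π.part m ∈ S ∧ ∀ i ∈ π.part m, m ≤ i

/-- The sizes of the classes which belong to `S`, ordered according to their first elements. -/
def openSizes : Fin (openMinima S π).card → ℕ :=
  fun i => (π.part ((openMinima S π).orderEmbOfFin rfl i)).card

/-- `R_{π∖S}(t) = t^{|π∖S|} ∏_{B ∈ π∖S} r_{|B|}`. -/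
def closedWeight (ν : Measure ℝ) (t : ℝ) : ℝ :=
  t ^ (π.parts \ S).card * ∏ B ∈ π.parts \ S, levyMoment ν B.card

end Partitions

/-! Partition-dependent stochastic measures. -/

section StochasticMeasures

/-- A subdivision `0 = t₀ < t₁ < ⋯ < t_N = t` of `[0, t)` into `N` intervals `[tᵢ₋₁, tᵢ)`. -/
structure Subdivision (t : ℝ) where
  size : ℕ
  point : Fin (size + 1) → ℝ
  strictMono : StrictMono point
  point_zero : point 0 = 0
  point_last : point (Fin.last size) = t

/-- `δ(I)`, the maximal length of an interval of the subdivision. -/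
def Subdivision.mesh {t : ℝ} (I : Subdivision t) : ℝ :=
  ⨆ i : Fin I.size, (I.point i.succ - I.point i.castSucc)

/-- The filter `δ(I) → 0` on the subdivisions of `[0, t)`. -/
def meshFilter (t : ℝ) : Filter (Subdivision t) :=
  comap Subdivision.mesh (𝓝 0)

variable (q : Set.Ioo (-1 : ℝ) 1) (ν : Measure ℝ) [IsFiniteMeasure ν] (hν : IsCompact ν.support)
  {n : ℕ} (π : SetPartition n)

/-- `St_π(t; I)`, the sum of `X(I_{u(1)}) ⋯ X(I_{u(n)})` over all `u : {1, …, n} → {1, …, N}` such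
that `u(i) = u(j)` if and only if `i` and `j` belong to the same class of `π`. -/
def stSum {t : ℝ} (I : Subdivision t) : Module.End ℂ (FockAlg q (OneParticle ν)) :=
  ∑ u ∈ Finset.univ.filter (fun u : Fin n → Fin I.size =>
      ∀ i j, u i = u j ↔ ∃ B ∈ π.parts, i ∈ B ∧ j ∈ B),
    (List.ofFn fun i => levyX q ν hν (I.point (u i).castSucc) (I.point (u i).succ)).prod

/-- `v` is the partition-dependent stochastic measure `St_π(t)`, that is, the `L²`-limit of
`St_π(t; I)` as `δ(I) → 0`. -/
def IsStochasticMeasure (t : ℝ) (v : FockSpace q (OneParticle ν)) : Prop :=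
  Tendsto (fun I : Subdivision t => applyVacuum q ν (stSum q ν hν π I)) (meshFilter t) (𝓝 v)

end StochasticMeasures

end

end QLevy

/-! The sum `St_π(t; I)` runs over injective maps `w` from the classes of `π` to the cells of the
subdivision. For fixed `w`, apply the factors `X(I_{w(c)})` to the vacuum from right to left. The
cells are disjoint, so such an operator reacts only with tensor factors of its own class `c`: it
creates `χ ⊗ 1`, raises a factor `χ ⊗ xᵐ` to `χ ⊗ x^{m+1}` and moves it to the front, or annihilates
that factor and leaves the scalar `|I_{w(c)}| r_{m+2}`. In the last two cases the weight is `q` to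
the number of factors standing on its left. The result has the same shape for all `w`: one formal
combination of states `(a, l)`, where `a c` counts the lengths `|I_{w(c)}|` produced and `l` lists
the surviving factors (`levyX_prod_vacuum`).

The analytic half is the limit of a single state. Its sum over `w` is the image of a step function
under the linear map that sends the indicator of a box to a tensor product. This map is bounded in
the `L²` norm, because the `q`-inner product is a weighted sum over permutations, each acting
isometrically on `L²` (`norm_le_of_mem_boxGraph`). The step functions converge in `L²` by dominated
convergence (`tendsto_stepL2`). Let the weight of a class be its number of lengths plus its number
of factors, and let all weights be positive. If some weight is at least 2 the limit is zero, since a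
cell then contributes an additional vanishing length or must contain two distinct points. If all
weights are 1, the limit is a power of `t` times the indicator of `[0,t)^k`.

The combinatorial half determines the states with all weights 1. Each class must be created at its
last element, raised at the intermediate ones, and at its first element either raised (the class
stays open, is in `S`, and leaves `x^{|B|-1}`) or closed (giving `t r_{|B|}`). A singleton cannot be
closed, which agrees with `r₁ = 0`. Every processed factor moves to the front, so the factors remain
sorted by the first elements of the traces of their classes. Hence the power of `q` picked up at `k`
counts the open traces which begin before the next element of the class, and this is `rcAt`
(`rcAt_of_nonempty`). Descending induction on `k` keeps exactly these states modulo negligible ones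
(`formalProd_sub_mainSum_mem`).

The same bounded map shows that the multiple integrals are single-valued and identifies the full
stochastic measures with elementary tensors (`fullMeasure_eq`). -/

namespace QLevy

open MeasureTheory Filter Topology
open scoped TensorProduct ENNReal ComplexConjugate

noncomputable section

/-! ### Elementary tensors indexed by lists, and the Fock space operators on them. -/

section ListVectors

variable {H : Type*} [NormedAddCommGroup H] [InnerProductSpace ℂ H] (q : Set.Ioo (-1 : ℝ) 1)

/-- The elementary tensor `ξ₁ ⊗ ⋯ ⊗ ξₙ` of the algebraic Fock space. -/
def listVec (l : List H) : FockAlg q H :=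
  FockAlg.incl q l.length (PiTensorProduct.tprod ℂ l.get)

theorem incl_tprod {n : ℕ} (f : Fin n → H) :
    FockAlg.incl q n (PiTensorProduct.tprod ℂ f) = listVec q (List.ofFn f) := by
  have key : ∀ (m : ℕ) (g : Fin m → H) (h : n = m), (∀ i, g (Fin.cast h i) = f i) →
      FockAlg.incl q n (PiTensorProduct.tprod ℂ f) =
        FockAlg.incl q m (PiTensorProduct.tprod ℂ g) := by
    rintro m g rfl h
    congr 2
    ext i
    exact (h i).symm
  exact key _ _ (by simp) fun i => by simp

theorem vacuum_eq_listVec : vacuum q H = listVec q [] := by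
  rw [vacuum, incl_tprod, List.ofFn_zero]

theorem creation_incl (ζ : H) (n : ℕ) (v : ⨂[ℂ]^n H) :
    creation q ζ (FockAlg.incl q n v) = FockAlg.incl q (n + 1) (creationN n ζ v) :=
  DirectSum.toModule_lof _ _ _

theorem annihilation_incl_zero (ζ : H) (v : ⨂[ℂ]^0 H) :
    annihilation q ζ (FockAlg.incl q 0 v) = 0 :=
  DirectSum.toModule_lof _ _ _

theorem annihilation_incl_succ (ζ : H) (n : ℕ) (v : ⨂[ℂ]^(n + 1) H) :
    annihilation q ζ (FockAlg.incl q (n + 1) v) = FockAlg.incl q n (annihilationN q n ζ v) :=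
  DirectSum.toModule_lof _ _ _

theorem gauge_incl_zero (T : H →L[ℂ] H) (v : ⨂[ℂ]^0 H) :
    gauge q T (FockAlg.incl q 0 v) = 0 :=
  DirectSum.toModule_lof _ _ _

theorem gauge_incl_succ (T : H →L[ℂ] H) (n : ℕ) (v : ⨂[ℂ]^(n + 1) H) :
    gauge q T (FockAlg.incl q (n + 1) v) = FockAlg.incl q (n + 1) (gaugeN q n T v) :=
  DirectSum.toModule_lof _ _ _

theorem creation_listVec (ζ : H) (l : List H) :
    creation q ζ (listVec q l) = listVec q (ζ :: l) := by
  rw [listVec, creation_incl, creationN_tprod, incl_tprod, List.ofFn_succ]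
  simp

theorem ofFn_removeNth {α : Type*} {n : ℕ} (f : Fin (n + 1) → α) (k : Fin (n + 1)) :
    List.ofFn (k.removeNth f) = (List.ofFn f).eraseIdx k := by
  refine List.ext_getElem (by
    rw [List.length_ofFn, List.length_eraseIdx_of_lt (by rw [List.length_ofFn]; exact k.2), List.length_ofFn]
    rfl) fun i h1 h2 => ?_
  simp only [List.length_ofFn] at h1
  rw [List.getElem_eraseIdx, List.getElem_ofFn]
  simp only [Fin.removeNth, Fin.succAbove, Fin.lt_def, List.getElem_ofFn]
  by_cases h : i < (k : ℕ)
  · simp [h]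
  · simp [h]

theorem annihilation_ofFn (ζ : H) {n : ℕ} (f : Fin n → H) :
    annihilation q ζ (listVec q (List.ofFn f)) =
      ∑ k : Fin n, ((q : ℂ) ^ (k : ℕ) * inner ℂ ζ (f k)) •
        listVec q ((List.ofFn f).eraseIdx k) := by
  rw [← incl_tprod]
  cases n with
  | zero => simp [annihilation_incl_zero]
  | succ n =>
    rw [annihilation_incl_succ, annihilationN_tprod, map_sum]
    refine Finset.sum_congr rfl fun k _ => ?_
    rw [map_smul, incl_tprod, ofFn_removeNth]

theorem gauge_ofFn (T : H →L[ℂ] H) {n : ℕ} (f : Fin n → H) :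
    gauge q T (listVec q (List.ofFn f)) =
      ∑ k : Fin n, ((q : ℂ) ^ (k : ℕ)) •
        listVec q (T (f k) :: (List.ofFn f).eraseIdx k) := by
  rw [← incl_tprod]
  cases n with
  | zero => simp [gauge_incl_zero]
  | succ n =>
    rw [gauge_incl_succ, gaugeN_tprod, map_sum]
    refine Finset.sum_congr rfl fun k _ => ?_
    rw [map_smul, incl_tprod, ← ofFn_removeNth, List.ofFn_cons]

theorem ofFn_map_getElem {α β : Type*} (g : α → β) (l : List α) :
    List.ofFn (fun k : Fin l.length => g l[k]) = l.map g := by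
  refine List.ext_getElem (by simp) fun i h1 h2 => ?_
  simp

theorem annihilation_listVec_map {α : Type*} (ζ : H) (g : α → H) (l : List α) :
    annihilation q ζ (listVec q (l.map g)) =
      ∑ k : Fin l.length, ((q : ℂ) ^ (k : ℕ) * inner ℂ ζ (g l[k])) •
        listVec q ((l.eraseIdx k).map g) := by
  rw [← ofFn_map_getElem, annihilation_ofFn]
  simp only [ofFn_map_getElem, List.eraseIdx_map]

theorem gauge_listVec_map {α : Type*} (T : H →L[ℂ] H) (g : α → H) (l : List α) :
    gauge q T (listVec q (l.map g)) =
      ∑ k : Fin l.length, ((q : ℂ) ^ (k : ℕ)) •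
        listVec q (T (g l[k]) :: (l.eraseIdx k).map g) := by
  rw [← ofFn_map_getElem, gauge_ofFn]
  simp only [ofFn_map_getElem, List.eraseIdx_map]

theorem listVec_zero_cons (l : List H) : listVec q (0 :: l) = 0 := by
  rw [← creation_listVec]
  have h : creationN l.length (0 : H) = 0 := by
    rw [creationN, map_zero, map_zero]
  rw [listVec, creation_incl, h, LinearMap.zero_apply, map_zero]

theorem inner_incl_tprod {n : ℕ} (f g : Fin n → H) :
    inner ℂ (FockAlg.incl q n (PiTensorProduct.tprod ℂ f))
      (FockAlg.incl q n (PiTensorProduct.tprod ℂ g)) =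
      ∑ σ : Equiv.Perm (Fin n), ((q : ℝ) : ℂ) ^ inversions σ * ∏ i, inner ℂ (f i) (g (σ i)) := by
  change innerQ _ _ = _
  have hc : ∀ (v : ⨂[ℂ]^n H) (m : ℕ), m ≠ n → FockAlg.component m (FockAlg.incl q n v) = 0 :=
    by
    intro v m hm
    change DirectSum.component ℂ ℕ (fun n => ⨂[ℂ]^n H) m
      (DirectSum.lof ℂ ℕ (fun n => ⨂[ℂ]^n H) n v) = 0
    rw [DirectSum.component.of, dif_neg hm.symm]
  have hs : ∀ v : ⨂[ℂ]^n H, FockAlg.component n (FockAlg.incl q n v) = v :=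
    by
    intro v
    change DirectSum.component ℂ ℕ (fun n => ⨂[ℂ]^n H) n
      (DirectSum.lof ℂ ℕ (fun n => ⨂[ℂ]^n H) n v) = v
    rw [DirectSum.component.lof_self]
  rw [innerQ, finsum_eq_single _ n fun m hm => by rw [hc _ m hm]; simp, hs, hs,
    inner0_qSym_tprod]

end ListVectors

/-! ### Inner products and products of the vectors `χ_I ⊗ xᵏ`. -/

section Increments

variable (ν : Measure ℝ) [IsFiniteMeasure ν] (hν : IsCompact ν.support)

/-- The length of `[a, b) ∩ [c, d) ∩ ℝ₊`. -/
def overlap (a b c d : ℝ) : ℝ :=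
  ((volume : Measure ℝ).restrict (Set.Ici 0)).real (Set.Ico a b ∩ Set.Ico c d)

theorem overlap_self {a b : ℝ} (ha : 0 ≤ a) (hab : a ≤ b) : overlap a b a b = b - a := by
  rw [overlap, Set.inter_self, measureReal_restrict_apply measurableSet_Ico,
    Set.inter_eq_left.2 fun x (hx : x ∈ Set.Ico a b) => Set.mem_Ici.2 (ha.trans hx.1), Real.volume_real_Ico_of_le hab]

theorem overlap_of_disjoint {a b c d : ℝ} (h : Disjoint (Set.Ico a b) (Set.Ico c d)) :
    overlap a b c d = 0 := by
  rw [overlap, h.inter_eq, measureReal_empty]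

theorem integral_indicator_mul_indicator (μ : Measure ℝ) (a b c d : ℝ) :
    ∫ x, (Set.Ico a b).indicator (fun _ => (1 : ℂ)) x * (Set.Ico c d).indicator (fun _ => 1) x ∂μ =
      (μ.real (Set.Ico a b ∩ Set.Ico c d) : ℂ) := by
  have : ∀ x, (Set.Ico a b).indicator (fun _ => (1 : ℂ)) x *
      (Set.Ico c d).indicator (fun _ => 1) x =
      (Set.Ico a b ∩ Set.Ico c d).indicator (fun _ => (1 : ℂ)) x := fun x => by
    by_cases h1 : x ∈ Set.Ico a b <;> by_cases h2 : x ∈ Set.Ico c d <;> simp [h1, h2]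
  simp only [this]
  rw [integral_indicator (measurableSet_Ico.inter measurableSet_Ico), setIntegral_const]
  simp

/-- Fubini separates time from the variable of `ν`. This is the source of both scalars of an
annihilation: a length of an interval and a moment of `ν`. -/
theorem inner_incrVec (k l : ℕ) (a b c d : ℝ) :
    inner ℂ (incrVec ν hν k a b) (incrVec ν hν l c d) =
      (overlap a b c d : ℂ) * ((∫ x, x ^ (k + l) ∂ν : ℝ) : ℂ) := by
  rw [L2.inner_def]
  have h1 := (memLp_two_incrFun ν hν k a b).coeFn_toLp
  have h2 := (memLp_two_incrFun ν hν l c d).coeFn_toLp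
  have : ∫ z, inner ℂ (incrVec ν hν k a b z) (incrVec ν hν l c d z) ∂(baseMeasure ν) =
      ∫ z : ℝ × ℝ, ((Set.Ico a b).indicator (fun _ => (1 : ℂ)) z.1 *
        (Set.Ico c d).indicator (fun _ => 1) z.1) * (z.2 : ℂ) ^ (k + l)
        ∂((volume.restrict (Set.Ici 0)).prod ν) := by
    refine integral_congr_ae ?_
    filter_upwards [h1, h2] with z hz1 hz2
    rw [incrVec, incrVec, hz1, hz2, RCLike.inner_apply, incrFun, incrFun]
    by_cases h1 : z.1 ∈ Set.Ico a b <;> by_cases h2 : z.1 ∈ Set.Ico c d <;>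
      simp [h1, h2, pow_add, mul_comm]
  rw [this]
  have := integral_prod_mul (μ := (volume : Measure ℝ).restrict (Set.Ici 0)) (ν := ν)
    (fun x => (Set.Ico a b).indicator (fun _ => (1 : ℂ)) x *
      (Set.Ico c d).indicator (fun _ => 1) x) (fun x : ℝ => (x : ℂ) ^ (k + l))
  refine this.trans ?_
  rw [integral_indicator_mul_indicator, overlap, ← integral_complex_ofReal]
  simp

theorem incrOp_incrVec (k l : ℕ) (a b : ℝ) :
    incrOp ν hν k a b (incrVec ν hν l a b) = incrVec ν hν (k + l) a b := by
  refine Lp.ext ?_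
  have h1 := (memLp_two_incrFun ν hν l a b).coeFn_toLp
  have h2 := (memLp_top_incrFun ν hν k a b).coeFn_toLp
  have h3 := (memLp_two_incrFun ν hν (k + l) a b).coeFn_toLp
  have h4 := (ContinuousLinearMap.mul ℂ ℂ).coeFn_holder (r := 2)
    (memLp_top_incrFun ν hν k a b).toLp (memLp_two_incrFun ν hν l a b).toLp
  filter_upwards [h1, h2, h3, h4] with z z1 z2 z3 z4
  rw [incrVec, incrVec, z3]
  refine z4.trans ?_
  rw [z1, z2, ContinuousLinearMap.mul_apply', incrFun, incrFun, incrFun]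
  by_cases h : z.1 ∈ Set.Ico a b <;> simp [h, pow_add]

theorem incrOp_incrVec_of_disjoint (k l : ℕ) {a b c d : ℝ}
    (h : Disjoint (Set.Ico a b) (Set.Ico c d)) :
    incrOp ν hν k a b (incrVec ν hν l c d) = 0 := by
  refine Lp.ext ?_
  have h1 := (memLp_two_incrFun ν hν l c d).coeFn_toLp
  have h2 := (memLp_top_incrFun ν hν k a b).coeFn_toLp
  have h3 := Lp.coeFn_zero ℂ 2 (baseMeasure ν)
  have h4 := (ContinuousLinearMap.mul ℂ ℂ).coeFn_holder (r := 2)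
    (memLp_top_incrFun ν hν k a b).toLp (memLp_two_incrFun ν hν l c d).toLp
  filter_upwards [h1, h2, h3, h4] with z z1 z2 z3 z4
  rw [z3]
  refine z4.trans ?_
  rw [z1, z2, ContinuousLinearMap.mul_apply', incrFun, incrFun]
  by_cases h' : z.1 ∈ Set.Ico a b
  · simp [Set.disjoint_left.1 h h']
  · simp [h']

end Increments

/-! ### The `L²`-bounded map from box indicators to tensors. -/

section BoxBound

/-- The measure `dt^{⊗k}` on `ℝ₊ᵏ`. -/
abbrev boxMeasure (k : ℕ) : Measure (Fin k → ℝ) :=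
  Measure.pi fun _ : Fin k => (volume : Measure ℝ).restrict (Set.Ici 0)

theorem measurePreserving_comp_perm {k : ℕ} (σ : Equiv.Perm (Fin k)) :
    MeasurePreserving (fun s : Fin k → ℝ => s ∘ σ.symm) (boxMeasure k) (boxMeasure k) := by
  have h := measurePreserving_piCongrLeft (α := fun _ : Fin k => ℝ)
    (fun _ => (volume : Measure ℝ).restrict (Set.Ici 0)) σ
  convert h using 1
  ext s i
  obtain ⟨j, rfl⟩ := σ.surjective i
  rw [MeasurableEquiv.coe_piCongrLeft, Equiv.piCongrLeft_apply_apply]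
  simp

theorem memLp_box {k : ℕ} (a b : Fin k → ℝ) :
    MemLp ((Set.univ.pi fun i => Set.Ico (a i) (b i)).indicator fun _ => (1 : ℂ)) 2
      (boxMeasure k) :=
  memLp_indicator_const 2 (MeasurableSet.univ_pi fun _ => measurableSet_Ico) 1
    (Or.inr (measure_box_ne_top a b))

/-- The action of the permutations on `L²(ℝ₊ᵏ)`. -/
def permL2 {k : ℕ} (σ : Equiv.Perm (Fin k)) : L2Box k →ₗᵢ[ℂ] L2Box k :=
  Lp.compMeasurePreservingₗᵢ ℂ _ (measurePreserving_comp_perm σ)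

theorem permL2_boxIndicator {k : ℕ} (σ : Equiv.Perm (Fin k)) (a b : Fin k → ℝ) :
    permL2 σ (boxIndicator a b) = boxIndicator (a ∘ σ) (b ∘ σ) := by
  refine (Lp.toLp_compMeasurePreserving (memLp_box a b) (measurePreserving_comp_perm σ)).trans ?_
  refine MemLp.toLp_congr _ (memLp_box _ _) (Filter.Eventually.of_forall fun s => ?_)
  have : (s ∘ σ.symm ∈ Set.univ.pi fun i => Set.Ico (a i) (b i)) ↔
      s ∈ Set.univ.pi fun i => Set.Ico ((a ∘ σ) i) ((b ∘ σ) i) := by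
    simp only [Set.mem_univ_pi, Function.comp_apply]
    exact ⟨fun h i => by simpa using h (σ i), fun h i => by simpa using h (σ.symm i)⟩
  classical
  rw [Function.comp_apply, Set.indicator_apply, Set.indicator_apply]
  exact if_congr this rfl rfl

theorem inner_boxIndicator {k : ℕ} (a b c d : Fin k → ℝ) :
    inner ℂ (boxIndicator a b) (boxIndicator c d) =
      ∏ i, (overlap (a i) (b i) (c i) (d i) : ℂ) := by
  rw [boxIndicator, boxIndicator, L2.inner_indicatorConstLp_one, setIntegral_indicatorConstLp,
    ← Set.pi_inter_distrib, Measure.real, Measure.pi_pi, ENNReal.toReal_prod]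
  · simp [overlap, Measure.real, Set.inter_comm]
  · exact MeasurableSet.univ_pi fun _ => measurableSet_Ico

variable (q : Set.Ioo (-1 : ℝ) 1) (ν : Measure ℝ) [IsFiniteMeasure ν] (hν : IsCompact ν.support)

/-- The vector `(χ_{[a₁, b₁)} ⊗ x^{m₁}) ⊗ ⋯ ⊗ (χ_{[aₖ, bₖ)} ⊗ x^{mₖ})` of the `q`-Fock space. -/
def boxVec {k : ℕ} (m : Fin k → ℕ) (a b : Fin k → ℝ) : FockSpace q (OneParticle ν) :=
  (FockAlg.incl q k (PiTensorProduct.tprod ℂ fun i => incrVec ν hν (m i) (a i) (b i)) :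
    FockAlg q (OneParticle ν))

/-- The graph of the linear map `χ_{I₁ × ⋯ × Iₖ} ↦ (χ_{I₁} ⊗ x^{m₁}) ⊗ ⋯ ⊗ (χ_{Iₖ} ⊗ x^{mₖ})`. -/
def boxGraph {k : ℕ} (m : Fin k → ℕ) : Submodule ℂ (L2Box k × FockSpace q (OneParticle ν)) :=
  Submodule.span ℂ {p | ∃ a b : Fin k → ℝ, p = (boxIndicator a b, boxVec q ν hν m a b)}

/-- The coefficient of a permutation in the inner product of vectors of `boxGraph`. -/
def permCoeff {k : ℕ} (m : Fin k → ℕ) (σ : Equiv.Perm (Fin k)) : ℂ :=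
  ((q : ℝ) : ℂ) ^ inversions σ * ∏ i, ((∫ x, x ^ (m i + m (σ i)) ∂ν : ℝ) : ℂ)

/-- In the permutation expansion of the `q`-inner product every term splits into a product of
moments, which forms the coefficient, and a product of overlaps, which is the pairing of one box
with a permuted box. Both sides are sesquilinear, so boxes suffice. -/
theorem inner_of_mem_boxGraph {k : ℕ} (m : Fin k → ℕ)
    {p p' : L2Box k × FockSpace q (OneParticle ν)} (hp : p ∈ boxGraph q ν hν m)
    (hp' : p' ∈ boxGraph q ν hν m) :
    inner ℂ p.2 p'.2 =
      ∑ σ : Equiv.Perm (Fin k), permCoeff q ν m σ * inner ℂ p.1 (permL2 σ p'.1) := by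
  refine Submodule.span_induction₂ (R := ℂ) (p := fun p p' _ _ => inner ℂ p.2 p'.2 =
      ∑ σ : Equiv.Perm (Fin k), permCoeff q ν m σ * inner ℂ p.1 (permL2 σ p'.1))
    ?_ ?_ ?_ ?_ ?_ ?_ ?_ hp hp'
  · rintro _ _ ⟨a, b, rfl⟩ ⟨c, d, rfl⟩
    simp only [boxVec]
    rw [UniformSpace.Completion.inner_coe, inner_incl_tprod]
    refine Finset.sum_congr rfl fun σ _ => ?_
    simp only [permL2_boxIndicator, inner_boxIndicator, inner_incrVec, permCoeff,
      Finset.prod_mul_distrib, Function.comp_apply]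
    ring
  · intro y _
    simp
  · intro x _
    simp
  · intro x y z _ _ _ h1 h2
    simp only [Prod.snd_add, Prod.fst_add, inner_add_left, h1, h2, mul_add,
      Finset.sum_add_distrib]
  · intro x y z _ _ _ h1 h2
    simp only [Prod.snd_add, Prod.fst_add, inner_add_right, h1, h2, mul_add, map_add,
      Finset.sum_add_distrib]
  · intro r x y _ _ h
    simp only [Prod.smul_snd, Prod.smul_fst, inner_smul_left, h, Finset.mul_sum]
    exact Finset.sum_congr rfl fun σ _ => by ring
  · intro r x y _ _ h
    simp only [Prod.smul_snd, Prod.smul_fst, inner_smul_right, h, Finset.mul_sum, map_smul]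
    exact Finset.sum_congr rfl fun σ _ => by ring

/-- The norm bound for the map with graph `boxGraph`. -/
def boxBound {k : ℕ} (m : Fin k → ℕ) : ℝ :=
  Real.sqrt (∑ σ : Equiv.Perm (Fin k), ‖permCoeff q ν m σ‖)

/-- Cauchy–Schwarz in each term of the permutation formula, since permuting coordinates preserves
the `L²` norm. In particular the relation `boxGraph` is single-valued: the tensor depends only on
the step function and not on its decomposition into boxes. -/
theorem norm_le_of_mem_boxGraph {k : ℕ} (m : Fin k → ℕ)
    {p : L2Box k × FockSpace q (OneParticle ν)} (hp : p ∈ boxGraph q ν hν m) :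
    ‖p.2‖ ≤ boxBound q ν m * ‖p.1‖ := by
  have h0 : 0 ≤ ∑ σ : Equiv.Perm (Fin k), ‖permCoeff q ν m σ‖ :=
    Finset.sum_nonneg fun _ _ => norm_nonneg _
  refine le_of_sq_le_sq ?_ (mul_nonneg (Real.sqrt_nonneg _) (norm_nonneg _))
  rw [mul_pow, boxBound, Real.sq_sqrt h0]
  have h1 : ‖inner ℂ p.2 p.2‖ = ‖p.2‖ ^ 2 := by
    rw [inner_self_eq_norm_sq_to_K]
    simp
  rw [← h1, inner_of_mem_boxGraph q ν hν m hp hp, Finset.sum_mul]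
  refine (norm_sum_le _ _).trans (Finset.sum_le_sum fun σ _ => ?_)
  rw [norm_mul]
  refine mul_le_mul_of_nonneg_left ?_ (norm_nonneg _)
  refine (norm_inner_le_norm _ _).trans ?_
  rw [LinearIsometry.norm_map, sq]

theorem norm_le_of_mem_closure_boxGraph {k : ℕ} (m : Fin k → ℕ)
    {p : L2Box k × FockSpace q (OneParticle ν)}
    (hp : p ∈ (boxGraph q ν hν m).topologicalClosure) :
    ‖p.2‖ ≤ boxBound q ν m * ‖p.1‖ := by
  have hc : IsClosed {p : L2Box k × FockSpace q (OneParticle ν) |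
      ‖p.2‖ ≤ boxBound q ν m * ‖p.1‖} := isClosed_le (by fun_prop) (by fun_prop)
  exact closure_minimal (fun x hx => norm_le_of_mem_boxGraph q ν hν m hx) hc hp

/-- Convergence in Fock space is thereby reduced to convergence of scalar functions in `L²`. -/
theorem tendsto_of_mem_boxGraph {k : ℕ} (m : Fin k → ℕ) {ι : Type*} {l : Filter ι}
    {F : ι → L2Box k} {Z : ι → FockSpace q (OneParticle ν)} {F₀ : L2Box k}
    {Z₀ : FockSpace q (OneParticle ν)} (h : ∀ i, (F i, Z i) ∈ boxGraph q ν hν m)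
    (h₀ : (F₀, Z₀) ∈ boxGraph q ν hν m) (hF : Tendsto F l (𝓝 F₀)) : Tendsto Z l (𝓝 Z₀) := by
  rw [tendsto_iff_norm_sub_tendsto_zero] at hF ⊢
  have hF' := hF.const_mul (boxBound q ν m)
  rw [mul_zero] at hF'
  exact squeeze_zero (fun _ => norm_nonneg _)
    (fun i => norm_le_of_mem_boxGraph q ν hν m ((boxGraph q ν hν m).sub_mem (h i) h₀)) hF'

end BoxBound

/-! ### Sums over injective maps. -/

section Combinatorics

variable {C J : Type*} [Fintype C] [DecidableEq C] [Fintype J] [DecidableEq J]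

/-- Fixing the common value `j₀` of `w` at `c` and `c'` makes the coordinates of `w` independent
again, so the sum factors for each `j₀`. -/
theorem sum_prod_filter_eq (g : C → J → ℝ) {c c' : C} (hc : c ≠ c') :
    ∑ w : C → J with w c = w c', ∏ d, g d (w d) =
      (∏ d ∈ Finset.univ \ {c, c'}, ∑ j, g d j) * ∑ j, g c j * g c' j := by
  have split : ∀ f : C → ℝ, ∏ d, f d = (∏ d ∈ Finset.univ \ {c, c'}, f d) * (f c * f c') := by
    intro f
    rw [← Finset.prod_sdiff (Finset.subset_univ {c, c'}), Finset.prod_pair hc]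
  -- The constraint `w c = j₀ = w c'` is absorbed into the factors of these two coordinates.
  let G : J → C → J → ℝ := fun j₀ d j =>
    if d = c ∨ d = c' then (if j = j₀ then g d j else 0) else g d j
  have hG : ∀ j₀, ∀ d ∈ Finset.univ \ {c, c'}, G j₀ d = g d := by
    intro j₀ d hd
    ext j
    have : ¬ (d = c ∨ d = c') := by simpa using hd
    simp [G, this]
  have h1 : ∀ w : C → J, (if w c = w c' then ∏ d, g d (w d) else 0) =
      ∑ j₀, ∏ d, G j₀ d (w d) := by
    intro w
    have : ∀ j₀, ∏ d, G j₀ d (w d) = (∏ d ∈ Finset.univ \ {c, c'}, g d (w d)) *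
        (if w c = j₀ then (if w c' = w c then g c (w c) * g c' (w c') else 0) else 0) := by
      intro j₀
      rw [split, Finset.prod_congr rfl fun d hd => by rw [hG j₀ d hd]]
      congr 1
      simp only [G, true_or, or_true, if_true]
      by_cases h : w c = j₀
      · subst h
        simp
      · simp [h]
    simp only [this, ← Finset.mul_sum, Finset.sum_ite_eq, Finset.mem_univ, if_true]
    rw [split]
    by_cases h : w c = w c'
    · simp [h]
    · simp [h, Ne.symm h]
  rw [Finset.sum_filter, Finset.sum_congr rfl fun w _ => h1 w, Finset.sum_comm, Finset.mul_sum]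
  refine Finset.sum_congr rfl fun j₀ _ => ?_
  rw [← Fintype.prod_sum, split, Finset.prod_congr rfl fun d hd => by rw [hG j₀ d hd]]
  congr 1
  simp [G]

/-- A sum over injective maps differs from the sum over all maps by the sums over the maps which
identify two given points. -/
theorem abs_sum_injective_sub_le (g : C → J → ℝ) (hg : ∀ c j, 0 ≤ g c j) :
    |∑ w : C → J with Function.Injective w, ∏ d, g d (w d) - ∏ d, ∑ j, g d j| ≤
      ∑ p : C × C with p.1 ≠ p.2,
        (∏ d ∈ Finset.univ \ {p.1, p.2}, ∑ j, g d j) * ∑ j, g p.1 j * g p.2 j := by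
  have hpos : ∀ w : C → J, 0 ≤ ∏ d, g d (w d) := fun w => Finset.prod_nonneg fun d _ => hg d _
  rw [Fintype.prod_sum, ← Finset.sum_filter_add_sum_filter_not Finset.univ
    (fun w : C → J => Function.Injective w), sub_add_cancel_left, abs_neg,
    abs_of_nonneg (Finset.sum_nonneg fun w _ => hpos w)]
  -- What remains is the sum over non-injective maps; each of them occurs on the right for at least
  -- one pair that it identifies.
  rw [Finset.sum_congr rfl fun p hp =>
    (sum_prod_filter_eq g (Finset.mem_filter.1 hp).2).symm.trans (Finset.sum_filter _ _),
    Finset.sum_comm, Finset.sum_filter]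
  refine Finset.sum_le_sum fun w _ => ?_
  have h0 : ∀ p : C × C, 0 ≤ if w p.1 = w p.2 then ∏ d, g d (w d) else 0 := fun p => by
    split_ifs
    exacts [hpos w, le_rfl]
  split_ifs with hw
  · exact Finset.sum_nonneg fun p _ => h0 p
  · obtain ⟨c, c', h1, h2⟩ := Function.not_injective_iff.1 hw
    have := Finset.single_le_sum (s := Finset.univ.filter fun p : C × C => p.1 ≠ p.2)
      (f := fun p => if w p.1 = w p.2 then ∏ d, g d (w d) else 0) (fun p _ => h0 p)
      (a := (c, c')) (by simpa using h2)
    rwa [if_pos h1] at this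

end Combinatorics

/-! ### Subdivisions of `[0, t)` and the sum over the cells for one class. -/

section Subdivisions

variable {t : ℝ}

instance : (meshFilter t).IsCountablyGenerated := by
  unfold meshFilter
  infer_instance

namespace Subdivision

variable (I : Subdivision t)

/-- The left endpoint of an interval of a subdivision. -/
def lo (j : Fin I.size) : ℝ := I.point j.castSucc

/-- The right endpoint of an interval of a subdivision. -/
def hi (j : Fin I.size) : ℝ := I.point j.succ

/-- The length of an interval of a subdivision. -/
def len (j : Fin I.size) : ℝ := I.hi j - I.lo j

/-- The indicator function of an interval of a subdivision. -/
def chi (j : Fin I.size) (x : ℝ) : ℝ := (Set.Ico (I.lo j) (I.hi j)).indicator (fun _ => 1) x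

theorem lo_lt_hi (j : Fin I.size) : I.lo j < I.hi j := I.strictMono Fin.castSucc_lt_succ

theorem lo_nonneg (j : Fin I.size) : 0 ≤ I.lo j := by
  rw [← I.point_zero]
  exact I.strictMono.monotone (Fin.zero_le _)

theorem hi_le (j : Fin I.size) : I.hi j ≤ t := by
  exact (I.strictMono.monotone (Fin.le_last _)).trans_eq I.point_last

theorem len_nonneg (j : Fin I.size) : 0 ≤ I.len j := sub_nonneg.2 (I.lo_lt_hi j).le

theorem len_le_mesh (j : Fin I.size) : I.len j ≤ I.mesh :=
  le_ciSup (f := fun i : Fin I.size => I.point i.succ - I.point i.castSucc)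
    (Set.finite_range _).bddAbove j

theorem mesh_nonneg : 0 ≤ I.mesh := Real.iSup_nonneg fun j => I.len_nonneg j

theorem nonneg (I : Subdivision t) : 0 ≤ t :=
  calc (0 : ℝ) = I.point 0 := I.point_zero.symm
    _ ≤ I.point (Fin.last _) := I.strictMono.monotone (Fin.zero_le _)
    _ = t := I.point_last

theorem disjoint {i j : Fin I.size} (h : i ≠ j) :
    Disjoint (Set.Ico (I.lo i) (I.hi i)) (Set.Ico (I.lo j) (I.hi j)) := by
  wlog hij : i < j generalizing i j
  · exact (this h.symm (lt_of_le_of_ne (not_lt.1 hij) h.symm)).symm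
  refine Set.disjoint_left.2 fun x hx hx' => ?_
  have : I.hi i ≤ I.lo j := I.strictMono.monotone (by
    rw [Fin.le_def, Fin.val_succ, Fin.val_castSucc]
    exact hij)
  exact absurd (hx.2.trans_le this) (not_lt.2 hx'.1)

theorem sum_succ_sub_castSucc {N : ℕ} (f : Fin (N + 1) → ℝ) :
    ∑ j : Fin N, (f j.succ - f j.castSucc) = f (Fin.last N) - f 0 := by
  induction N with
  | zero => simp
  | succ N ih =>
    rw [Fin.sum_univ_castSucc]
    have := ih (fun j => f j.castSucc)
    simp only [Fin.succ_castSucc, Fin.castSucc_zero] at this ⊢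
    rw [this, Fin.succ_last]
    ring

theorem sum_len : ∑ j, I.len j = t := by
  refine (sum_succ_sub_castSucc I.point).trans ?_
  rw [I.point_last, I.point_zero, sub_zero]

theorem len_le (j : Fin I.size) : I.len j ≤ t := by
  have := I.lo_nonneg j
  have := I.hi_le j
  simp only [len]
  linarith

theorem chi_nonneg (j : Fin I.size) (x : ℝ) : 0 ≤ I.chi j x :=
  Set.indicator_nonneg (fun _ _ => zero_le_one) _

theorem chi_le_one (j : Fin I.size) (x : ℝ) : I.chi j x ≤ 1 :=
  Set.indicator_le_self' (fun _ _ => zero_le_one) _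

theorem mem_of_chi_ne_zero {j : Fin I.size} {x : ℝ} (h : I.chi j x ≠ 0) :
    x ∈ Set.Ico (I.lo j) (I.hi j) := Set.mem_of_indicator_ne_zero h

theorem mem_Ico_of_chi_ne_zero {j : Fin I.size} {x : ℝ} (h : I.chi j x ≠ 0) :
    x ∈ Set.Ico 0 t :=
  ⟨(I.lo_nonneg j).trans (I.mem_of_chi_ne_zero h).1, (I.mem_of_chi_ne_zero h).2.trans_le (I.hi_le j)⟩

theorem sum_chi {x : ℝ} (hx : x ∈ Set.Ico 0 t) : ∑ j, I.chi j x = 1 := by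
  -- The indicator of a cell is the difference of the values of `1_{x < point i}` at its two
  -- endpoints, so the sum telescopes.
  have h := sum_succ_sub_castSucc fun i => if x < I.point i then (1 : ℝ) else 0
  simp only [I.point_last, I.point_zero, hx.2, not_lt.2 hx.1, if_true, if_false, sub_zero] at h
  rw [← h]
  refine Finset.sum_congr rfl fun j _ => ?_
  have h1 := I.lo_lt_hi j
  simp only [lo, hi] at h1
  simp only [chi, lo, hi, Set.indicator, Set.mem_Ico]
  by_cases h2 : x < I.point j.castSucc
  · simp [h2, h2.trans h1]
  · simp [h2, not_lt.1 h2]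

/-- `∑_j |I_j|ᵃ ∏_{i ∈ B} χ_{I_j}(sᵢ)`. -/
def cellSum {k : ℕ} (a : ℕ) (B : Finset (Fin k)) (s : Fin k → ℝ) : ℝ :=
  ∑ j, I.len j ^ a * ∏ i ∈ B, I.chi j (s i)

theorem cellSum_nonneg {k : ℕ} (a : ℕ) (B : Finset (Fin k)) (s : Fin k → ℝ) :
    0 ≤ I.cellSum a B s :=
  Finset.sum_nonneg fun j _ => mul_nonneg (pow_nonneg (I.len_nonneg j) _)
    (Finset.prod_nonneg fun _ _ => I.chi_nonneg j _)

/-- The hypothesis `h` excludes the sum that merely counts cells. Either a coordinate selects a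
single cell, or one length is summed to `t` while the others are at most `t`; `(1 + t) ^ a` covers
both cases uniformly in the subdivision. -/
theorem cellSum_le {k : ℕ} {a : ℕ} {B : Finset (Fin k)} {s : Fin k → ℝ}
    (hs : ∀ i, s i ∈ Set.Ico 0 t) (h : 1 ≤ a + B.card) : I.cellSum a B s ≤ (1 + t) ^ a := by
  have ht := I.nonneg
  have hB : ∀ j, ∏ i ∈ B, I.chi j (s i) ≤ 1 := fun j =>
    Finset.prod_le_one (fun i _ => I.chi_nonneg j _) fun i _ => I.chi_le_one j _
  cases a with
  | zero =>
    obtain ⟨i, hi⟩ := Finset.card_pos.1 (show 0 < B.card by omega)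
    rw [cellSum, pow_zero, ← I.sum_chi (hs i)]
    refine Finset.sum_le_sum fun j _ => ?_
    rw [pow_zero, one_mul, ← Finset.mul_prod_erase B _ hi]
    exact mul_le_of_le_one_right (I.chi_nonneg j _)
      (Finset.prod_le_one (fun _ _ => I.chi_nonneg j _) fun _ _ => I.chi_le_one j _)
  | succ a =>
    calc I.cellSum (a + 1) B s ≤ ∑ j, t ^ a * I.len j := by
          refine Finset.sum_le_sum fun j _ => ?_
          refine (mul_le_of_le_one_right (pow_nonneg (I.len_nonneg j) _) (hB j)).trans ?_
          rw [pow_succ]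
          exact mul_le_mul_of_nonneg_right (pow_le_pow_left₀ (I.len_nonneg j) (I.len_le j) a)
            (I.len_nonneg j)
      _ = t ^ (a + 1) := by rw [← Finset.mul_sum, I.sum_len, pow_succ]
      _ ≤ _ := pow_le_pow_left₀ ht (by linarith) _

end Subdivision

theorem tendsto_mesh : Tendsto Subdivision.mesh (meshFilter t) (𝓝 0) := tendsto_comap

/-- Weight 1 means one length or one coordinate, and the sum is constantly `t` or `1`. For a larger
weight with a length, a factor at most the mesh can be extracted. With two coordinates and no
length, no cell contains both points once the mesh is less than their distance. -/
theorem tendsto_cellSum {k : ℕ} {a : ℕ} {B : Finset (Fin k)} {s : Fin k → ℝ}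
    (hs : ∀ i, s i ∈ Set.Ico 0 t) (hinj : Function.Injective s) (h : 1 ≤ a + B.card) :
    Tendsto (fun I : Subdivision t => I.cellSum a B s) (meshFilter t)
      (𝓝 (if a + B.card = 1 then t ^ a else 0)) := by
  by_cases h1 : a + B.card = 1
  · rw [if_pos h1]
    refine tendsto_const_nhds.congr fun I => ?_
    rcases Nat.eq_zero_or_pos a with rfl | ha
    · obtain ⟨i, rfl⟩ := Finset.card_eq_one.1 (show B.card = 1 by omega)
      simp [Subdivision.cellSum, I.sum_chi (hs i)]
    · obtain rfl : a = 1 := by omega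
      obtain rfl : B = ∅ := Finset.card_eq_zero.1 (by omega)
      simp [Subdivision.cellSum, I.sum_len]
  rw [if_neg h1]
  cases a with
  | succ a =>
    have hb := (tendsto_mesh (t := t)).mul_const ((1 + t) ^ a)
    rw [zero_mul] at hb
    refine squeeze_zero (fun I => I.cellSum_nonneg _ _ _) (fun I => ?_) hb
    calc I.cellSum (a + 1) B s ≤ ∑ j, I.mesh * (I.len j ^ a * ∏ i ∈ B, I.chi j (s i)) := by
          refine Finset.sum_le_sum fun j _ => ?_
          rw [pow_succ', mul_assoc]
          exact mul_le_mul_of_nonneg_right (I.len_le_mesh j)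
            (mul_nonneg (pow_nonneg (I.len_nonneg j) _)
              (Finset.prod_nonneg fun i _ => I.chi_nonneg j _))
      _ = I.mesh * I.cellSum a B s := by rw [← Finset.mul_sum, Subdivision.cellSum]
      _ ≤ _ := mul_le_mul_of_nonneg_left (I.cellSum_le hs (by omega)) I.mesh_nonneg
  | zero =>
    obtain ⟨i, hi, i', hi', hne⟩ := Finset.one_lt_card.1 (show 1 < B.card by omega)
    have hd : 0 < |s i - s i'| := abs_pos.2 (sub_ne_zero.2 fun h => hne (hinj h))
    refine tendsto_const_nhds.congr' ?_
    filter_upwards [(tendsto_mesh (t := t)).eventually_lt_const hd] with I hI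
    refine (Finset.sum_eq_zero fun j _ => ?_).symm
    by_contra h0
    have h2 := Finset.prod_ne_zero_iff.1 (right_ne_zero_of_mul h0)
    have m1 := I.mem_of_chi_ne_zero (h2 i hi)
    have m2 := I.mem_of_chi_ne_zero (h2 i' hi')
    have h3 := I.len_le_mesh j
    have h4 : |s i - s i'| < I.len j := by
      simp only [Subdivision.len, Set.mem_Ico] at m1 m2 ⊢
      rw [abs_lt]
      constructor <;> linarith
    linarith

end Subdivisions

/-! ### `L²` convergence of the step functions of a state. -/

section StepFunctions

/-- Dominated convergence for `‖F i - F₀‖²` written as an integral. The filter must be countably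
generated, which `meshFilter` is as a comap of `𝓝 0`. -/
theorem tendsto_L2_of_dominated {α ι : Type*} [MeasurableSpace α] {μ : Measure α} {l : Filter ι}
    [l.IsCountablyGenerated] {F : ι → Lp ℂ 2 μ} {F₀ : Lp ℂ 2 μ} {f : ι → α → ℂ} {f₀ : α → ℂ}
    (hF : ∀ i, F i =ᵐ[μ] f i) (hF₀ : F₀ =ᵐ[μ] f₀) {bound : α → ℝ} (hb : Integrable bound μ)
    (hle : ∀ i x, ‖f i x - f₀ x‖ ^ 2 ≤ bound x)
    (hlim : ∀ᵐ x ∂μ, Tendsto (fun i => f i x) l (𝓝 (f₀ x))) : Tendsto F l (𝓝 F₀) := by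
  have hsub : ∀ i, ⇑(F i - F₀) =ᵐ[μ] fun x => f i x - f₀ x := fun i => by
    filter_upwards [Lp.coeFn_sub (F i) F₀, hF i, hF₀] with x h1 h2 h3
    rw [h1, Pi.sub_apply, h2, h3]
  have hnorm : ∀ i, ((‖F i - F₀‖ ^ 2 : ℝ) : ℂ) =
      ∫ x, inner ℂ (f i x - f₀ x) (f i x - f₀ x) ∂μ := fun i => by
    have h : inner ℂ (F i - F₀) (F i - F₀) = ((‖F i - F₀‖ ^ 2 : ℝ) : ℂ) := by
      rw [inner_self_eq_norm_sq_to_K]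
      simp
    rw [← h, L2.inner_def]
    refine integral_congr_ae ?_
    filter_upwards [hsub i] with x hx
    rw [hx]
  have h := tendsto_integral_filter_of_dominated_convergence (μ := μ) (l := l)
    (F := fun i x => inner ℂ (f i x - f₀ x) (f i x - f₀ x)) (f := fun _ => (0 : ℂ)) bound
    (Filter.Eventually.of_forall fun i => by
      have := (Lp.aestronglyMeasurable (F i - F₀)).congr (hsub i)
      exact this.inner this)
    (Filter.Eventually.of_forall fun i => Filter.Eventually.of_forall fun x => by
      rw [inner_self_eq_norm_sq_to_K]
      simpa using hle i x) hb
    (by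
      filter_upwards [hlim] with x hx
      have h0 : Tendsto (fun i => f i x - f₀ x) l (𝓝 0) := by
        simpa using hx.sub_const (f₀ x)
      simpa using h0.inner (𝕜 := ℂ) h0)
  simp only [← hnorm, integral_zero] at h
  have h' : Tendsto (fun i => ‖F i - F₀‖ ^ 2) l (𝓝 0) := by
    have := (Complex.continuous_re.tendsto _).comp h
    simpa only [Function.comp_def, Complex.ofReal_re, Complex.zero_re] using this
  rw [tendsto_iff_norm_sub_tendsto_zero]
  have := (Real.continuous_sqrt.tendsto _).comp h'
  simpa only [Function.comp_def, Real.sqrt_sq (norm_nonneg _), Real.sqrt_zero] using this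

/-- Each diagonal `s i = s j` is a proper linear subspace, hence a Lebesgue null set. -/
theorem ae_injective (k : ℕ) : ∀ᵐ s ∂(boxMeasure k), Function.Injective s := by
  have hac : boxMeasure k ≪ volume := by
    rw [boxMeasure, ← Measure.restrict_pi_pi]
    exact Measure.absolutelyContinuous_of_le Measure.restrict_le_self
  refine hac.ae_le ?_
  have h : ∀ p : Fin k × Fin k, ∀ᵐ s : Fin k → ℝ, p.1 ≠ p.2 → s p.1 ≠ s p.2 := by
    rintro ⟨i, j⟩
    by_cases hij : i = j
    · exact Filter.Eventually.of_forall fun s h => absurd hij h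
    let V : Submodule ℝ (Fin k → ℝ) :=
      LinearMap.ker (LinearMap.proj (R := ℝ) (φ := fun _ : Fin k => ℝ) i - LinearMap.proj j)
    have hV : V ≠ ⊤ := fun h => by
      have : Pi.single i (1 : ℝ) ∈ V := h ▸ Submodule.mem_top
      simp [V, Ne.symm hij] at this
    have := Measure.addHaar_submodule volume V hV
    refine measure_mono_null (fun s hs => ?_) this
    simp only [Set.mem_compl_iff, Set.mem_ofPred_eq, not_forall, not_not] at hs
    obtain ⟨_, hs⟩ := hs
    simpa [V, sub_eq_zero] using hs
  filter_upwards [ae_all_iff.2 h] with s hs i j hij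
  by_contra hne
  exact hs (i, j) hne hij

variable {C : Type*} [DecidableEq C] {t : ℝ}

/-- The positions which belong to the class `c`. -/
def fiber {k : ℕ} (cl : Fin k → C) (c : C) : Finset (Fin k) :=
  Finset.univ.filter fun i => cl i = c

namespace Subdivision

variable (I : Subdivision t)

/-- The factor of a class in a summand of `stepFun`. -/
def cell {k : ℕ} (a : C → ℕ) (cl : Fin k → C) (s : Fin k → ℝ) (c : C) (j : Fin I.size) : ℝ :=
  I.len j ^ a c * ∏ i ∈ fiber cl c, I.chi j (s i)

theorem cell_nonneg {k : ℕ} (a : C → ℕ) (cl : Fin k → C) (s : Fin k → ℝ) (c : C)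
    (j : Fin I.size) : 0 ≤ I.cell a cl s c j :=
  mul_nonneg (pow_nonneg (I.len_nonneg j) _) (Finset.prod_nonneg fun _ _ => I.chi_nonneg j _)

/-- Two classes placed in the same cell behave as one class whose weight is the sum of theirs. The
error made by dropping injectivity therefore consists of cell sums of weight at least 2. -/
theorem sum_cell_mul_cell {k : ℕ} (a : C → ℕ) (cl : Fin k → C) (s : Fin k → ℝ) {c c' : C}
    (h : c ≠ c') : ∑ j, I.cell a cl s c j * I.cell a cl s c' j =
      I.cellSum (a c + a c') (fiber cl c ∪ fiber cl c') s := by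
  refine Finset.sum_congr rfl fun j _ => ?_
  have hd : Disjoint (fiber cl c) (fiber cl c') :=
    Finset.disjoint_filter.2 fun i _ h1 h2 => h (h1.symm.trans h2)
  rw [cell, cell, Finset.prod_union hd, pow_add]
  ring

variable [Fintype C]

/-- `∑_w ∏_c |I_{w(c)}|^{a(c)} ∏_i χ_{I_{w(cl(i))}}(sᵢ)`, the sum being over the injective maps `w`. -/
def stepFun {k : ℕ} (a : C → ℕ) (cl : Fin k → C) (s : Fin k → ℝ) : ℝ :=
  ∑ w : C → Fin I.size with Function.Injective w,
    (∏ c, I.len (w c) ^ a c) * ∏ i, I.chi (w (cl i)) (s i)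

/-- The step function `stepFun` as an element of `L²`. -/
def stepL2 {k : ℕ} (a : C → ℕ) (cl : Fin k → C) : L2Box k :=
  ∑ w : C → Fin I.size with Function.Injective w,
    ((∏ c, I.len (w c) ^ a c : ℝ) : ℂ) •
      boxIndicator (fun i => I.lo (w (cl i))) (fun i => I.hi (w (cl i)))

theorem stepFun_eq {k : ℕ} (a : C → ℕ) (cl : Fin k → C) (s : Fin k → ℝ) :
    I.stepFun a cl s = ∑ w : C → Fin I.size with Function.Injective w,
      ∏ c, I.cell a cl s c (w c) := by
  refine Finset.sum_congr rfl fun w _ => ?_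
  simp only [cell]
  rw [Finset.prod_mul_distrib, ← Finset.prod_fiberwise Finset.univ cl]
  congr 1
  refine Finset.prod_congr rfl fun c _ => Finset.prod_congr rfl fun i hi => ?_
  rw [(Finset.mem_filter.1 hi).2]

theorem stepFun_nonneg {k : ℕ} (a : C → ℕ) (cl : Fin k → C) (s : Fin k → ℝ) :
    0 ≤ I.stepFun a cl s := by
  rw [stepFun_eq]
  exact Finset.sum_nonneg fun w _ => Finset.prod_nonneg fun c _ => I.cell_nonneg a cl s c _

/-- All terms are nonnegative, so injectivity can be dropped; the sum then factors over the classes.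
-/
theorem stepFun_le {k : ℕ} {a : C → ℕ} {cl : Fin k → C} {s : Fin k → ℝ}
    (hs : ∀ i, s i ∈ Set.Ico 0 t) (h : ∀ c, 1 ≤ a c + (fiber cl c).card) :
    I.stepFun a cl s ≤ ∏ c, (1 + t) ^ a c := by
  rw [stepFun_eq]
  calc _ ≤ ∑ w : C → Fin I.size, ∏ c, I.cell a cl s c (w c) :=
        Finset.sum_le_sum_of_subset_of_nonneg (Finset.filter_subset _ _) fun w _ _ =>
          Finset.prod_nonneg fun c _ => I.cell_nonneg a cl s c _
    _ = ∏ c, ∑ j, I.cell a cl s c j := (Fintype.prod_sum _).symm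
    _ ≤ _ := Finset.prod_le_prod
        (fun c _ => Finset.sum_nonneg fun j _ => I.cell_nonneg a cl s c j)
        fun c _ => I.cellSum_le hs (h c)

theorem stepFun_of_notMem {k : ℕ} (a : C → ℕ) (cl : Fin k → C) {s : Fin k → ℝ} {i : Fin k}
    (hs : s i ∉ Set.Ico 0 t) : I.stepFun a cl s = 0 := by
  refine Finset.sum_eq_zero fun w _ => ?_
  rw [Finset.prod_eq_zero (Finset.mem_univ i), mul_zero]
  by_contra h
  exact hs (I.mem_Ico_of_chi_ne_zero h)

theorem stepL2_ae_eq {k : ℕ} (a : C → ℕ) (cl : Fin k → C) :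
    I.stepL2 a cl =ᵐ[boxMeasure k] fun s => (I.stepFun a cl s : ℂ) := by
  have h1 : ∀ᵐ s ∂(boxMeasure k), ∀ w : C → Fin I.size,
      (boxIndicator (fun i => I.lo (w (cl i))) (fun i => I.hi (w (cl i))) : L2Box k) s =
        (Set.univ.pi fun i => Set.Ico (I.lo (w (cl i))) (I.hi (w (cl i)))).indicator
          (fun _ => (1 : ℂ)) s := ae_all_iff.2 fun w => indicatorConstLp_coeFn
  have h2 : ∀ᵐ s ∂(boxMeasure k), ∀ w : C → Fin I.size,
      (((∏ c, I.len (w c) ^ a c : ℝ) : ℂ) •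
        boxIndicator (fun i => I.lo (w (cl i))) (fun i => I.hi (w (cl i))) : L2Box k) s =
      ((∏ c, I.len (w c) ^ a c : ℝ) : ℂ) •
        (boxIndicator (fun i => I.lo (w (cl i))) (fun i => I.hi (w (cl i))) : L2Box k) s :=
    ae_all_iff.2 fun w => Lp.coeFn_smul _ _
  have h3 := Lp.coeFn_finsetSum (Finset.univ.filter fun w : C → Fin I.size => Function.Injective w)
    fun w => ((∏ c, I.len (w c) ^ a c : ℝ) : ℂ) •
      (boxIndicator (fun i => I.lo (w (cl i))) (fun i => I.hi (w (cl i))) : L2Box k)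
  filter_upwards [h1, h2, h3] with s h1 h2 h3
  refine h3.trans ?_
  rw [Finset.sum_apply, stepFun, Complex.ofReal_sum]
  refine Finset.sum_congr rfl fun w _ => ?_
  rw [h2, h1, smul_eq_mul, Complex.ofReal_mul]
  congr 1
  by_cases hs : ∀ i, s i ∈ Set.Ico (I.lo (w (cl i))) (I.hi (w (cl i)))
  · rw [Set.indicator_of_mem (Set.mem_univ_pi.2 hs), Finset.prod_eq_one, Complex.ofReal_one]
    exact fun i _ => Set.indicator_of_mem (hs i) _
  · obtain ⟨i, hi⟩ := not_forall.1 hs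
    rw [Set.indicator_of_notMem fun h => hs (Set.mem_univ_pi.1 h),
      Finset.prod_eq_zero (Finset.mem_univ i) (Set.indicator_of_notMem hi _), Complex.ofReal_zero]

end Subdivision

variable [Fintype C]

/-- The limit of `stepFun` off the diagonals. -/
def stepLimit {k : ℕ} (t : ℝ) (a : C → ℕ) (cl : Fin k → C) : ℝ :=
  ∏ c, if a c + (fiber cl c).card = 1 then t ^ a c else 0

/-- Without injectivity the sum is a product of cell sums with known limits. The correction is
bounded by terms in which two classes share a cell, and these tend to zero. -/
theorem tendsto_stepFun {k : ℕ} {a : C → ℕ} {cl : Fin k → C} {s : Fin k → ℝ}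
    (hs : ∀ i, s i ∈ Set.Ico 0 t) (hinj : Function.Injective s)
    (h : ∀ c, 1 ≤ a c + (fiber cl c).card) :
    Tendsto (fun I : Subdivision t => I.stepFun a cl s) (meshFilter t)
      (𝓝 (stepLimit t a cl)) := by
  have h1 : Tendsto (fun I : Subdivision t => ∏ c, ∑ j, I.cell a cl s c j) (meshFilter t)
      (𝓝 (stepLimit t a cl)) :=
    tendsto_finsetProd _ fun c _ => tendsto_cellSum hs hinj (h c)
  have h2 : Tendsto (fun I : Subdivision t => ∑ p : C × C with p.1 ≠ p.2,
        (∏ d ∈ Finset.univ \ {p.1, p.2}, ∑ j, I.cell a cl s d j) *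
          ∑ j, I.cell a cl s p.1 j * I.cell a cl s p.2 j) (meshFilter t) (𝓝 0) := by
    rw [← Finset.sum_const_zero (ι := C × C) (s := Finset.univ.filter fun p => p.1 ≠ p.2)]
    refine tendsto_finsetSum _ fun p hp => ?_
    have hp := (Finset.mem_filter.1 hp).2
    have e1 := tendsto_finsetProd (Finset.univ \ {p.1, p.2}) fun d _ =>
      tendsto_cellSum hs hinj (h d)
    have hcard : (fiber cl p.1 ∪ fiber cl p.2).card =
        (fiber cl p.1).card + (fiber cl p.2).card :=
      Finset.card_union_of_disjoint
        (Finset.disjoint_filter.2 fun i _ h1 h2 => hp (h1.symm.trans h2))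
    have := h p.1
    have := h p.2
    have e2 := tendsto_cellSum (a := a p.1 + a p.2) (B := fiber cl p.1 ∪ fiber cl p.2) hs hinj
      (by omega)
    rw [if_neg (by omega)] at e2
    have e := e1.mul e2
    rw [mul_zero] at e
    refine e.congr fun I => ?_
    rw [I.sum_cell_mul_cell a cl s hp]
    rfl
  have h3 : Tendsto (fun I : Subdivision t => I.stepFun a cl s - ∏ c, ∑ j, I.cell a cl s c j)
      (meshFilter t) (𝓝 0) := by
    refine squeeze_zero_norm (fun I => ?_) h2
    rw [I.stepFun_eq, Real.norm_eq_abs]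
    exact abs_sum_injective_sub_le _ fun c j => I.cell_nonneg a cl s c j
  have := h3.add h1
  simpa using this

theorem tendsto_stepL2 {k : ℕ} {a : C → ℕ} {cl : Fin k → C}
    (h : ∀ c, 1 ≤ a c + (fiber cl c).card) :
    Tendsto (fun I : Subdivision t => I.stepL2 a cl) (meshFilter t)
      (𝓝 ((stepLimit t a cl : ℂ) • boxIndicator (fun _ => 0) fun _ => t)) := by
  classical
  set D : Set (Fin k → ℝ) := Set.univ.pi fun _ => Set.Ico 0 t with hD
  let K : ℝ := ∏ c, (1 + t) ^ a c
  refine tendsto_L2_of_dominated (f₀ := fun s => (stepLimit t a cl : ℂ) * D.indicator 1 s)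
    (bound := D.indicator fun _ => (|K| + |stepLimit t a cl|) ^ 2)
    (fun I => I.stepL2_ae_eq a cl) ?_ ?_ (fun I s => ?_) ?_
  · filter_upwards [Lp.coeFn_smul (stepLimit t a cl : ℂ)
      (boxIndicator (fun _ => 0) fun _ => t : L2Box k),
      indicatorConstLp_coeFn (p := 2) (c := (1 : ℂ))
        (hs := MeasurableSet.univ_pi fun _ : Fin k => (measurableSet_Ico : MeasurableSet (Set.Ico 0 t)))
        (hμs := measure_box_ne_top (fun _ => 0) fun _ => t)] with s h1 h2
    rw [h1, Pi.smul_apply, smul_eq_mul]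
    congr 1
  · rw [integrable_indicator_iff (MeasurableSet.univ_pi fun _ => measurableSet_Ico)]
    exact integrableOn_const (measure_box_ne_top (fun _ => 0) fun _ => t)
  · by_cases hs : s ∈ D
    · rw [Set.indicator_of_mem hs, Set.indicator_of_mem hs, Pi.one_apply, mul_one,
        ← Complex.ofReal_sub, Complex.norm_real, Real.norm_eq_abs]
      refine pow_le_pow_left₀ (abs_nonneg _) ((abs_sub _ _).trans ?_) 2
      refine add_le_add_left ?_ _
      rw [abs_of_nonneg (I.stepFun_nonneg a cl s)]
      exact (I.stepFun_le (fun i => hs i (Set.mem_univ i)) h).trans (le_abs_self _)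
    · rw [Set.indicator_of_notMem hs, Set.indicator_of_notMem hs]
      obtain ⟨i, hi⟩ : ∃ i, s i ∉ Set.Ico 0 t := by simpa [hD] using hs
      simp [I.stepFun_of_notMem a cl hi]
  · filter_upwards [ae_injective k] with s hinj
    by_cases hs : s ∈ D
    · rw [Set.indicator_of_mem hs, Pi.one_apply, mul_one]
      exact (Complex.continuous_ofReal.tendsto _).comp
        (tendsto_stepFun (fun i => hs i (Set.mem_univ i)) hinj h)
    · obtain ⟨i, hi⟩ : ∃ i, s i ∉ Set.Ico 0 t := by simpa [hD] using hs
      simp [Subdivision.stepFun_of_notMem _ a cl hi, Set.indicator_of_notMem hs,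
        tendsto_const_nhds]

end StepFunctions

/-! ### Formal states: the action of `X(I_c)` freed from the choice of the intervals. -/

section FormalStates

variable {C : Type*}

/-- A state `(a, l)` stands for `∏_c |I_c|^{a(c)}` times the tensor product of the vectors
`χ_{I_c} ⊗ xᵐ`, `(c, m) ∈ l`. -/
abbrev State (C : Type*) : Type _ := (C → ℕ) × List (C × ℕ)

namespace State

/-- The creation of a vector `χ_{I_c} ⊗ 1`. -/
def create (s : State C) (c : C) : State C := (s.1, (c, 0) :: s.2)

/-- The multiplication of a vector by `x`. -/
def raiseAt (s : State C) (k : Fin s.2.length) : State C :=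
  (s.1, (s.2[k].1, s.2[k].2 + 1) :: s.2.eraseIdx k)

variable [DecidableEq C]

/-- The number of occurrences of a class in a state. -/
def weight (s : State C) (c : C) : ℕ := s.1 c + (s.2.map Prod.fst).count c

/-- The annihilation of a vector. -/
def closeAt (s : State C) (k : Fin s.2.length) : State C :=
  (s.1 + Pi.single s.2[k].1 1, s.2.eraseIdx k)

theorem weight_create (s : State C) (c d : C) :
    (s.create c).weight d = s.weight d + if c = d then 1 else 0 := by
  simp only [weight, create, List.map_cons, List.count_cons, beq_iff_eq]
  omega

theorem count_eraseIdx (l : List (C × ℕ)) (k : Fin l.length) (d : C) :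
    (l.map Prod.fst).count d =
      ((l.eraseIdx k).map Prod.fst).count d + if l[k].1 = d then 1 else 0 := by
  have h := ((List.getElem_cons_eraseIdx_perm k.2).map Prod.fst).count_eq d
  rw [← h, List.map_cons, List.count_cons]
  simp

/-- Closing exchanges a tensor factor for a length of the same class. Raising preserves weights as
well, so only creation increases them, and a weight of at least 2 can never be lost. -/
theorem weight_closeAt (s : State C) (k : Fin s.2.length) (d : C) :
    (s.closeAt k).weight d = s.weight d := by
  simp only [weight, closeAt, count_eraseIdx s.2 k d, Pi.add_apply, Pi.single_apply, eq_comm (a := d)]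
  omega

theorem weight_raiseAt (s : State C) (k : Fin s.2.length) (d : C) :
    (s.raiseAt k).weight d = s.weight d := by
  simp only [weight, raiseAt, count_eraseIdx s.2 k d, List.map_cons, List.count_cons, beq_iff_eq]

theorem weight_pos_of_getElem (s : State C) (k : Fin s.2.length) :
    1 + s.1 s.2[k].1 ≤ s.weight s.2[k].1 := by
  simp only [weight, count_eraseIdx s.2 k s.2[k].1, if_true]
  omega

theorem count_map_fst (l : List (C × ℕ)) (c : C) :
    (l.map Prod.fst).count c = (fiber (fun i : Fin l.length => l[i].1) c).card := by
  induction l with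
  | nil => simp [fiber]
  | cons x l ih =>
    rw [List.map_cons, List.count_cons, ih, fiber, fiber]
    refine Eq.trans ?_ (Fin.card_filter_univ_succ (n := l.length) fun i => (x :: l)[i].1 = c).symm
    by_cases h : x.1 = c
    · simp [h]
    · simp [h]

end State

variable [DecidableEq C] (q : ℝ) (r : ℕ → ℝ)

/-- The action of `X(I_c)` on a state. -/
def stepOn (c : C) (s : State C) : State C →₀ ℂ :=
  Finsupp.single (s.create c) 1 + ∑ k : Fin s.2.length,
    if s.2[k].1 = c then (q : ℂ) ^ (k : ℕ) • ((r (s.2[k].2 + 2) : ℂ) • Finsupp.single (s.closeAt k) 1 +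
      Finsupp.single (s.raiseAt k) 1) else 0

/-- The action of `X(I_c)` on formal linear combinations of states. -/
def stepMap (c : C) : (State C →₀ ℂ) →ₗ[ℂ] (State C →₀ ℂ) :=
  Finsupp.linearCombination ℂ (stepOn q r c)

theorem stepMap_single (c : C) (s : State C) (z : ℂ) :
    stepMap q r c (Finsupp.single s z) = z • stepOn q r c s :=
  Finsupp.linearCombination_single _ _ _

/-- The formal result of applying `X(I_{c₁}) ⋯ X(I_{cₙ})` to the vacuum. -/
def formalProd (l : List C) : State C →₀ ℂ :=
  l.foldr (fun c v => stepMap q r c v) (Finsupp.single (0, []) 1)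

end FormalStates

/-! ### From formal states to vectors, and their limits. -/

section Realization

variable {C : Type*}
variable (q : Set.Ioo (-1 : ℝ) 1) (ν : Measure ℝ) [IsFiniteMeasure ν] (hν : IsCompact ν.support)

theorem boxVec_getElem (l : List (C × ℕ)) (α β : C → ℝ) :
    boxVec q ν hν (fun i : Fin l.length => l[i].2) (fun i => α l[i].1) (fun i => β l[i].1) =
      ((listVec q (l.map fun p => incrVec ν hν p.2 (α p.1) (β p.1)) :
        FockAlg q (OneParticle ν)) : FockSpace q (OneParticle ν)) := by
  rw [boxVec, incl_tprod, ← ofFn_map_getElem]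

variable [DecidableEq C] [Fintype C]

/-- The vector for which a state stands when `I_c = [α(c), β(c))`. -/
def realize (α β : C → ℝ) (s : State C) : FockAlg q (OneParticle ν) :=
  ((∏ c, (β c - α c) ^ s.1 c : ℝ) : ℂ) •
    listVec q (s.2.map fun p => incrVec ν hν p.2 (α p.1) (β p.1))

/-- Disjointness kills every interaction with a factor of another class. The endpoints enter the
surviving terms only through `realize`, so `stepOn` need not know them. -/
theorem levyX_realize {α β : C → ℝ} (h0 : ∀ c, 0 ≤ α c ∧ α c ≤ β c)
    (hd : ∀ c c', c ≠ c' → Disjoint (Set.Ico (α c) (β c)) (Set.Ico (α c') (β c')))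
    (c : C) (s : State C) :
    levyX q ν hν (α c) (β c) (realize q ν hν α β s) =
      Finsupp.linearCombination ℂ (realize q ν hν α β) (stepOn q (levyMoment ν) c s) := by
  have e1 : levyX q ν hν (α c) (β c) = annihilation q (incrVec ν hν 0 (α c) (β c)) +
      creation q (incrVec ν hν 0 (α c) (β c)) + gauge q (incrOp ν hν 1 (α c) (β c)) := rfl
  have hin : ∀ p : C × ℕ, inner ℂ (incrVec ν hν 0 (α c) (β c))
      (incrVec ν hν p.2 (α p.1) (β p.1)) =
      if p.1 = c then ((β c - α c : ℝ) : ℂ) * (levyMoment ν (p.2 + 2) : ℂ) else 0 := by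
    rintro ⟨c', m⟩
    rw [inner_incrVec]
    split_ifs with h
    · obtain rfl : c' = c := h
      rw [overlap_self (h0 c').1 (h0 c').2, zero_add]
      rfl
    · rw [overlap_of_disjoint (hd c c' (Ne.symm h)), Complex.ofReal_zero, zero_mul]
  have hop : ∀ p : C × ℕ, ∀ l, listVec q (incrOp ν hν 1 (α c) (β c)
      (incrVec ν hν p.2 (α p.1) (β p.1)) :: l) =
      if p.1 = c then listVec q (incrVec ν hν (p.2 + 1) (α p.1) (β p.1) :: l) else 0 := by
    rintro ⟨c', m⟩ l
    split_ifs with h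
    · obtain rfl : c' = c := h
      rw [incrOp_incrVec, add_comm 1]
    · rw [incrOp_incrVec_of_disjoint _ _ _ _ (hd c c' (Ne.symm h)), listVec_zero_cons]
  -- The length produced by an annihilation is recorded by increasing the exponent of its class.
  have hprod : ∀ c' : C, ∏ d, (β d - α d) ^ ((s.1 + Pi.single c' 1 : C → ℕ) d) =
      (∏ d, (β d - α d) ^ s.1 d) * (β c' - α c') := by
    intro c'
    simp only [Pi.add_apply, pow_add, Finset.prod_mul_distrib]
    congr 1
    rw [Finset.prod_eq_single c' (fun d _ hd => by simp [hd]) (by simp)]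
    simp
  rw [realize, map_smul, e1, LinearMap.add_apply, LinearMap.add_apply, creation_listVec,
    annihilation_listVec_map, gauge_listVec_map, stepOn, map_add, map_sum,
    Finsupp.linearCombination_single, one_smul, add_right_comm, add_comm, smul_add]
  congr 1
  rw [← Finset.sum_add_distrib, Finset.smul_sum]
  refine Finset.sum_congr rfl fun k _ => ?_
  rw [hin, hop]
  split_ifs with h
  · simp only [map_smul, map_add, Finsupp.linearCombination_single, one_smul]
    rw [realize, realize]
    simp only [State.closeAt, State.raiseAt, hprod, h, List.map_cons, smul_add, smul_smul]
    congr 2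
    · push_cast
      ring
    · ring
  · simp

theorem levyX_linearCombination {α β : C → ℝ} (h0 : ∀ c, 0 ≤ α c ∧ α c ≤ β c)
    (hd : ∀ c c', c ≠ c' → Disjoint (Set.Ico (α c) (β c)) (Set.Ico (α c') (β c')))
    (c : C) (v : State C →₀ ℂ) :
    levyX q ν hν (α c) (β c) (Finsupp.linearCombination ℂ (realize q ν hν α β) v) =
      Finsupp.linearCombination ℂ (realize q ν hν α β) (stepMap q (levyMoment ν) c v) := by
  induction v using Finsupp.induction_linear with
  | zero => simp
  | add v w hv hw => simp only [map_add, hv, hw]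
  | single s z =>
    rw [stepMap_single, Finsupp.linearCombination_single, map_smul, map_smul,
      levyX_realize q ν hν h0 hd]

theorem levyX_prod_vacuum {α β : C → ℝ} (h0 : ∀ c, 0 ≤ α c ∧ α c ≤ β c)
    (hd : ∀ c c', c ≠ c' → Disjoint (Set.Ico (α c) (β c)) (Set.Ico (α c') (β c')))
    (l : List C) :
    (l.map fun c => levyX q ν hν (α c) (β c)).prod (vacuum q (OneParticle ν)) =
      Finsupp.linearCombination ℂ (realize q ν hν α β) (formalProd q (levyMoment ν) l) := by
  induction l with
  | nil => simp [formalProd, realize, vacuum_eq_listVec]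
  | cons c l ih =>
    rw [List.map_cons, List.prod_cons, Module.End.mul_apply, ih,
      levyX_linearCombination q ν hν h0 hd]
    rfl

/-- The limit of the sums of the vectors for which a state stands. -/
def stateLimit (t : ℝ) (s : State C) : FockSpace q (OneParticle ν) :=
  ((∏ c, if s.weight c = 1 then t ^ s.1 c else 0 : ℝ) : ℂ) •
    ((listVec q (s.2.map fun p => incrVec ν hν p.2 0 t) : FockAlg q (OneParticle ν)) :
      FockSpace q (OneParticle ν))

/-- The sum corresponds to `stepL2` under `boxGraph`, and so does the limit to a multiple of the
indicator of `[0,t)^k`; the latter box is allowed because `boxGraph` does not require disjoint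
sides. -/
theorem tendsto_sum_realize {t : ℝ} {s : State C} (hs : ∀ c, 1 ≤ s.weight c) :
    Tendsto (fun I : Subdivision t => ∑ w : C → Fin I.size with Function.Injective w,
      ((realize q ν hν (fun c => I.lo (w c)) (fun c => I.hi (w c)) s : FockAlg q (OneParticle ν)) :
        FockSpace q (OneParticle ν))) (meshFilter t) (𝓝 (stateLimit q ν hν t s)) := by
  let cl : Fin s.2.length → C := fun i => s.2[i].1
  have hw : ∀ c, s.weight c = s.1 c + (fiber cl c).card := fun c => by
    rw [State.weight, State.count_map_fst]
  refine tendsto_of_mem_boxGraph q ν hν (fun i : Fin s.2.length => s.2[i].2)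
    (fun I => ?_) ?_ (tendsto_stepL2 (a := s.1) (cl := cl) fun c => hw c ▸ hs c)
  · have : (I.stepL2 s.1 cl, ∑ w : C → Fin I.size with Function.Injective w,
        ((realize q ν hν (fun c => I.lo (w c)) (fun c => I.hi (w c)) s :
          FockAlg q (OneParticle ν)) : FockSpace q (OneParticle ν))) =
        ∑ w : C → Fin I.size with Function.Injective w, ((∏ c, I.len (w c) ^ s.1 c : ℝ) : ℂ) •
          (boxIndicator (fun i => I.lo (w (cl i))) (fun i => I.hi (w (cl i))),
            boxVec q ν hν (fun i : Fin s.2.length => s.2[i].2) (fun i => I.lo (w (cl i)))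
              (fun i => I.hi (w (cl i)))) := by
      refine Prod.ext ?_ ?_
      · rw [Prod.fst_sum]
        rfl
      · rw [Prod.snd_sum]
        refine Finset.sum_congr rfl fun w _ => ?_
        rw [Prod.smul_snd, boxVec_getElem q ν hν s.2 (fun c => I.lo (w c)) (fun c => I.hi (w c)),
          realize, UniformSpace.Completion.coe_smul]
        rfl
    rw [this]
    exact Submodule.sum_mem _ fun w _ => Submodule.smul_mem _ _ (Submodule.subset_span ⟨_, _, rfl⟩)
  · have : stateLimit q ν hν t s = (stepLimit t s.1 cl : ℂ) •
        boxVec q ν hν (fun i : Fin s.2.length => s.2[i].2) (fun _ => 0) (fun _ => t) := by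
      rw [boxVec_getElem q ν hν s.2 (fun _ => 0) (fun _ => t), stateLimit, stepLimit]
      simp only [hw]
    rw [this]
    exact (boxGraph q ν hν _).smul_mem _ (Submodule.subset_span ⟨_, _, rfl⟩)

theorem tendsto_sum_linearCombination {t : ℝ} {v : State C →₀ ℂ}
    (hv : v ∈ Finsupp.supported ℂ ℂ {s : State C | ∀ c, 1 ≤ s.weight c}) :
    Tendsto (fun I : Subdivision t => ∑ w : C → Fin I.size with Function.Injective w,
      ((Finsupp.linearCombination ℂ
        (realize q ν hν (fun c => I.lo (w c)) (fun c => I.hi (w c))) v : FockAlg q (OneParticle ν)) :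
        FockSpace q (OneParticle ν))) (meshFilter t)
      (𝓝 (Finsupp.linearCombination ℂ (stateLimit q ν hν t) v)) := by
  rw [Finsupp.supported_eq_span_single] at hv
  induction hv using Submodule.span_induction with
  | mem v hv =>
    obtain ⟨s, hs, rfl⟩ := hv
    simpa only [Finsupp.linearCombination_single, one_smul] using
      tendsto_sum_realize q ν hν hs
  | zero => simp [UniformSpace.Completion.coe_zero, tendsto_const_nhds]
  | add v w _ _ hv hw =>
    simpa only [map_add, UniformSpace.Completion.coe_add, Finset.sum_add_distrib] using hv.add hw
  | smul z v _ hv =>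
    simpa only [map_smul, UniformSpace.Completion.coe_smul, Finset.smul_sum] using hv.const_smul z

end Realization

/-! ### Well-definedness of the multiple stochastic integrals. -/

section Integrals

variable (q : Set.Ioo (-1 : ℝ) 1) (ν : Measure ℝ) [IsFiniteMeasure ν] (hν : IsCompact ν.support)

/-- On pairwise disjoint intervals the annihilation and gauge parts vanish and only creation acts.
-/
theorem levyY_prod_vacuum_list (l : List (ℕ × ℝ × ℝ))
    (hl : l.Pairwise fun x y => Disjoint (Set.Ico x.2.1 x.2.2) (Set.Ico y.2.1 y.2.2)) :
    (l.map fun x => levyY q ν hν x.1 x.2.1 x.2.2).prod (vacuum q (OneParticle ν)) =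
      listVec q (l.map fun x => incrVec ν hν (x.1 - 1) x.2.1 x.2.2) := by
  induction l with
  | nil => simp [vacuum_eq_listVec]
  | cons x l ih =>
    obtain ⟨h1, h2⟩ := List.pairwise_cons.1 hl
    rw [List.map_cons, List.prod_cons, Module.End.mul_apply, ih h2, levyY, fieldOp,
      LinearMap.add_apply, LinearMap.add_apply, creation_listVec, annihilation_listVec_map,
      gauge_listVec_map, Finset.sum_eq_zero, Finset.sum_eq_zero, zero_add, add_zero, List.map_cons]
    · intro k _
      have h := h1 l[k] (List.getElem_mem k.2)
      rw [incrOp_incrVec_of_disjoint _ _ _ _ h, listVec_zero_cons,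
        smul_zero]
    · intro k _
      have h := h1 l[k] (List.getElem_mem k.2)
      rw [inner_incrVec, overlap_of_disjoint h, Complex.ofReal_zero,
        zero_mul, mul_zero, zero_smul]

theorem levyY_prod_vacuum {k : ℕ} (u : Fin k → ℕ) (a b : Fin k → ℝ)
    (h : ∀ i j, i ≠ j → Disjoint (Set.Ico (a i) (b i)) (Set.Ico (a j) (b j))) :
    applyVacuum q ν (List.ofFn fun i => levyY q ν hν (u i) (a i) (b i)).prod =
      boxVec q ν hν (fun i => u i - 1) a b := by
  have := levyY_prod_vacuum_list q ν hν (List.ofFn fun i => (u i, a i, b i))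
    (List.pairwise_ofFn.2 fun i j hij => h i j hij.ne)
  rw [List.map_ofFn, List.map_ofFn] at this
  rw [boxVec, incl_tprod]
  exact congrArg (fun v : FockAlg q (OneParticle ν) => (v : FockSpace q (OneParticle ν))) this

theorem integralGraph_le {k : ℕ} (u : Fin k → ℕ) :
    integralGraph q ν hν u ≤ (boxGraph q ν hν fun i => u i - 1).topologicalClosure := by
  refine Submodule.topologicalClosure_mono (Submodule.span_mono ?_)
  rintro _ ⟨a, b, _, hd, rfl⟩
  exact ⟨a, b, by rw [levyY_prod_vacuum q ν hν u a b hd]⟩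

/-- The norm bound persists on the closure of the graph, so a pair with first component zero has
second component zero. -/
theorem IsMultipleIntegral.unique {k : ℕ} {u : Fin k → ℕ} {F : L2Box k}
    {v w : FockSpace q (OneParticle ν)} (hv : IsMultipleIntegral q ν hν u F v)
    (hw : IsMultipleIntegral q ν hν u F w) : v = w := by
  have h := norm_le_of_mem_closure_boxGraph q ν hν _
    (integralGraph_le q ν hν u ((integralGraph q ν hν u).sub_mem hv hw))
  simp only [Prod.mk_sub_mk, sub_self, norm_zero, mul_zero] at h
  exact sub_eq_zero.1 (norm_le_zero_iff.1 h)

theorem exists_mesh_lt {t : ℝ} (ht : 0 ≤ t) {ε : ℝ} (hε : 0 < ε) :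
    ∃ I : Subdivision t, I.mesh < ε := by
  rcases ht.eq_or_lt with rfl | ht
  -- For `t = 0` only the subdivision without cells exists; its mesh is a real supremum over an
  -- empty family, which is `0` by convention.
  · refine ⟨⟨0, fun _ => 0, Subsingleton.strictMono (α := Fin 1) _, rfl, rfl⟩, ?_⟩
    rw [Subdivision.mesh, Real.iSup_of_isEmpty]
    exact hε
  · obtain ⟨n, hn⟩ := exists_nat_gt (t / ε)
    have hn0 : (0 : ℝ) < n := (div_pos ht hε).trans hn
    refine ⟨⟨n, fun i => (i : ℕ) * (t / n), fun i j hij => ?_, by simp, ?_⟩, ?_⟩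
    · exact mul_lt_mul_of_pos_right (by exact_mod_cast hij) (div_pos ht hn0)
    · rw [Fin.val_last]
      field_simp
    · have : Nonempty (Fin n) := ⟨⟨0, by exact_mod_cast hn0⟩⟩
      have h : ∀ i : Fin n, ((i.succ : ℕ) * (t / n) - (i.castSucc : ℕ) * (t / n) : ℝ) = t / n := by
        intro i
        simp
        ring
      simp only [Subdivision.mesh, h, ciSup_const]
      rwa [div_lt_comm₀ hn0 hε]

theorem meshFilter_neBot {t : ℝ} (ht : 0 ≤ t) : (meshFilter t).NeBot := by
  refine comap_neBot fun s hs => ?_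
  obtain ⟨ε, hε, h⟩ := Metric.mem_nhds_iff.1 hs
  obtain ⟨I, hI⟩ := exists_mesh_lt ht hε
  exact ⟨I, h (by rwa [mem_ball_zero_iff, Real.norm_eq_abs, abs_of_nonneg I.mesh_nonneg])⟩

/-- The cube `[0,t)^k` is approximated by the union of the boxes with pairwise distinct sides from a
subdivision. The omitted diagonal part disappears in the limit, and the tensors follow by the norm
bound. -/
theorem isMultipleIntegral_boxVec {k : ℕ} (u : Fin k → ℕ) {t : ℝ} (ht : 0 ≤ t) :
    IsMultipleIntegral q ν hν u (boxIndicator (fun _ => 0) fun _ => t)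
      (boxVec q ν hν (fun i => u i - 1) (fun _ => 0) fun _ => t) := by
  have := meshFilter_neBot ht
  have hfib : ∀ c : Fin k, (fiber id c).card = 1 := fun c =>
    Finset.card_eq_one.2 ⟨c, by ext; simp [fiber]⟩
  -- Every coordinate is its own class and no lengths occur, so all weights are 1.
  have h1 := tendsto_stepL2 (t := t) (a := fun _ : Fin k => 0) (cl := id) fun c => by
    rw [hfib]
  have hlim : stepLimit t (fun _ : Fin k => 0) id = 1 := by
    simp [stepLimit, hfib]
  rw [hlim, Complex.ofReal_one, one_smul] at h1
  let Z : Subdivision t → FockSpace q (OneParticle ν) := fun I =>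
    ∑ w : Fin k → Fin I.size with Function.Injective w,
      boxVec q ν hν (fun i => u i - 1) (fun i => I.lo (w i)) (fun i => I.hi (w i))
  have hZ : ∀ I : Subdivision t, (I.stepL2 (fun _ : Fin k => 0) id, Z I) =
      ∑ w : Fin k → Fin I.size with Function.Injective w,
        (boxIndicator (fun i => I.lo (w i)) (fun i => I.hi (w i)),
          boxVec q ν hν (fun i => u i - 1) (fun i => I.lo (w i)) (fun i => I.hi (w i))) := by
    intro I
    refine Prod.ext ?_ ?_
    · rw [Prod.fst_sum]
      simp [Subdivision.stepL2]
    · rw [Prod.snd_sum]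
  have h2 : Tendsto Z (meshFilter t)
      (𝓝 (boxVec q ν hν (fun i => u i - 1) (fun _ => 0) fun _ => t)) := by
    refine tendsto_of_mem_boxGraph q ν hν (fun i => u i - 1) (fun I => ?_)
      (Submodule.subset_span ⟨_, _, rfl⟩) h1
    rw [hZ]
    exact Submodule.sum_mem _ fun w _ => Submodule.subset_span ⟨_, _, rfl⟩
  refine mem_closure_of_tendsto (h1.prodMk_nhds h2) (Filter.Eventually.of_forall fun I => ?_)
  rw [hZ]
  refine Submodule.sum_mem (Submodule.span ℂ _) fun w hw => Submodule.subset_span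
    ⟨fun i => I.lo (w i), fun i => I.hi (w i), fun i => ⟨I.lo_nonneg _, I.lo_lt_hi _⟩, ?_⟩
  have hd : ∀ i j, i ≠ j → Disjoint (Set.Ico (I.lo (w i)) (I.hi (w i)))
      (Set.Ico (I.lo (w j)) (I.hi (w j))) :=
    fun i j hij => I.disjoint fun h => hij ((Finset.mem_filter.1 hw).2 h)
  exact ⟨hd, by rw [levyY_prod_vacuum q ν hν u _ _ hd]⟩

theorem existsUnique_isMultipleIntegral {k : ℕ} (u : Fin k → ℕ) {t : ℝ} (ht : 0 ≤ t) :
    ∃! v, IsMultipleIntegral q ν hν u (boxIndicator (fun _ => 0) fun _ => t) v :=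
  ⟨_, isMultipleIntegral_boxVec q ν hν u ht, fun _ hv =>
    hv.unique q ν hν (isMultipleIntegral_boxVec q ν hν u ht)⟩

theorem fullMeasure_eq {k : ℕ} (u : Fin k → ℕ) {t : ℝ} (ht : 0 ≤ t) :
    fullMeasure q ν hν u t = boxVec q ν hν (fun i => u i - 1) (fun _ => 0) fun _ => t := by
  have h : ∃ v, IsMultipleIntegral q ν hν u (boxIndicator (fun _ => 0) fun _ => t) v :=
    ⟨_, isMultipleIntegral_boxVec q ν hν u ht⟩
  rw [fullMeasure, multipleIntegral, dif_pos h]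
  exact h.choose_spec.unique q ν hν (isMultipleIntegral_boxVec q ν hν u ht)

end Integrals

/-! ### `St_π(t; I)` as a sum of realizations of one formal vector. -/

section StochasticSums

variable (q : Set.Ioo (-1 : ℝ) 1) (ν : Measure ℝ) [IsFiniteMeasure ν] (hν : IsCompact ν.support)
  {n : ℕ} (π : SetPartition n)

/-- The class of a point. -/
def classOf (i : Fin n) : π.parts := ⟨π.part i, π.part_mem.2 (Finset.mem_univ i)⟩

theorem classOf_eq_iff {i j : Fin n} : classOf π i = classOf π j ↔ π.part i = π.part j :=
  Subtype.ext_iff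

theorem exists_classOf (c : π.parts) : ∃ i, classOf π i = c := by
  obtain ⟨i, hi⟩ := π.nonempty_of_mem_parts c.2
  exact ⟨i, Subtype.ext (π.part_eq_of_mem c.2 hi)⟩

theorem exists_mem_parts_iff {i j : Fin n} :
    (∃ B ∈ π.parts, i ∈ B ∧ j ∈ B) ↔ classOf π i = classOf π j := by
  rw [classOf_eq_iff]
  constructor
  · rintro ⟨B, hB, hi, hj⟩
    rw [π.part_eq_of_mem hB hi, π.part_eq_of_mem hB hj]
  · intro h
    exact ⟨π.part i, π.part_mem.2 (Finset.mem_univ i), π.mem_part (Finset.mem_univ i),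
      h ▸ π.mem_part (Finset.mem_univ j)⟩

/-- The admissible `u` are exactly the maps `w ∘ classOf π` with `w` injective, and injectivity of
`w` supplies the disjoint cells. -/
theorem applyVacuum_stSum {t : ℝ} (I : Subdivision t) :
    applyVacuum q ν (stSum q ν hν π I) =
      ∑ w : π.parts → Fin I.size with Function.Injective w,
        ((Finsupp.linearCombination ℂ
          (realize q ν hν (fun c => I.lo (w c)) (fun c => I.hi (w c)))
          (formalProd q (levyMoment ν) (List.ofFn (classOf π))) : FockAlg q (OneParticle ν)) :
          FockSpace q (OneParticle ν)) := by
  rw [stSum, map_sum]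
  symm
  refine Finset.sum_bij (fun w _ => w ∘ classOf π) ?_ ?_ ?_ ?_
  · intro w hw
    have hw := (Finset.mem_filter.1 hw).2
    refine Finset.mem_filter.2 ⟨Finset.mem_univ _, fun i j => ?_⟩
    rw [exists_mem_parts_iff]
    exact hw.eq_iff
  · intro w _ w' _ h
    funext c
    obtain ⟨i, rfl⟩ := exists_classOf π c
    exact congrFun h i
  · intro u hu
    have hu := (Finset.mem_filter.1 hu).2
    simp only [exists_mem_parts_iff] at hu
    choose rep hrep using exists_classOf π
    refine ⟨fun c => u (rep c), Finset.mem_filter.2 ⟨Finset.mem_univ _, fun c c' h => ?_⟩, ?_⟩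
    · rw [← hrep c, ← hrep c']
      exact (hu _ _).1 h
    · funext i
      exact (hu _ _).2 (hrep _)
  · intro w hw
    have hw := (Finset.mem_filter.1 hw).2
    rw [← levyX_prod_vacuum q ν hν (fun c => ⟨I.lo_nonneg _, (I.lo_lt_hi _).le⟩)
      fun c c' hc => I.disjoint fun h => hc (hw h), List.map_ofFn]
    rfl

theorem applyVacuum_stSum_mem {t : ℝ} (I : Subdivision t) :
    applyVacuum q ν (stSum q ν hν π I) ∈ levyL2 q ν hν := by
  refine Submodule.le_topologicalClosure _ (Submodule.mem_map_of_mem ?_)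
  refine Subalgebra.sum_mem _ fun u _ => Subalgebra.list_prod_mem _ fun A hA => ?_
  obtain ⟨i, rfl⟩ := List.mem_ofFn.1 hA
  exact Algebra.subset_adjoin ⟨_, _, I.lo_nonneg _, I.lo_lt_hi _, rfl⟩

theorem isStochasticMeasure_of_supported {t : ℝ}
    (h : formalProd q (levyMoment ν) (List.ofFn (classOf π)) ∈
      Finsupp.supported ℂ ℂ {s : State π.parts | ∀ c, 1 ≤ s.weight c}) :
    IsStochasticMeasure q ν hν π t (Finsupp.linearCombination ℂ (stateLimit q ν hν t)
      (formalProd q (levyMoment ν) (List.ofFn (classOf π)))) := by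
  have := tendsto_sum_linearCombination q ν hν (t := t) h
  simp only [← applyVacuum_stSum q ν hν π] at this
  exact this

end StochasticSums

/-! ### Splitting a sorted list at one of its elements. -/

section SortedLists

variable {α : Type*} [LinearOrder α]

theorem sort_union_of_lt {s t : Finset α} (h : ∀ a ∈ s, ∀ b ∈ t, a < b) :
    (s ∪ t).sort = s.sort ++ t.sort := by
  have hn : (s.sort ++ t.sort).Nodup := List.nodup_append.2 ⟨s.sort_nodup _, t.sort_nodup _,
    fun a ha b hb => (h a ((Finset.mem_sort _).1 ha) b ((Finset.mem_sort _).1 hb)).ne⟩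
  have hp : (s.sort ++ t.sort).Pairwise (· ≤ ·) := List.pairwise_append.2
    ⟨s.pairwise_sort _, t.pairwise_sort _,
      fun a ha b hb => (h a ((Finset.mem_sort _).1 ha) b ((Finset.mem_sort _).1 hb)).le⟩
  rw [← (List.toFinset_sort (· ≤ ·) hn).2 hp, List.toFinset_append, Finset.sort_toFinset,
    Finset.sort_toFinset]

theorem sort_eq_append (s : Finset α) {a : α} (ha : a ∈ s) :
    s.sort = (s.filter (· < a)).sort ++ a :: (s.filter (a < ·)).sort := by
  rw [← Finset.sort_insert (· ≤ ·) (fun b hb => (Finset.mem_filter.1 hb).2.le) (by simp),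
    ← sort_union_of_lt]
  · congr 1
    ext b
    rcases lt_trichotomy b a with h | rfl | h
    · simp [h, h.ne, h.not_gt]
    · simp [ha]
    · simp [h, h.ne', h.not_gt]
  · intro x hx y hy
    have hx := (Finset.mem_filter.1 hx).2
    rcases Finset.mem_insert.1 hy with rfl | hy
    · exact hx
    · exact hx.trans (Finset.mem_filter.1 hy).2

theorem sort_erase_eq_append (s : Finset α) (a : α) :
    (s.erase a).sort = (s.filter (· < a)).sort ++ (s.filter (a < ·)).sort := by
  rw [← sort_union_of_lt fun x hx y hy =>
    (Finset.mem_filter.1 hx).2.trans (Finset.mem_filter.1 hy).2]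
  congr 1
  ext b
  rw [Finset.mem_erase, Finset.mem_union, Finset.mem_filter, Finset.mem_filter, ← and_or_left,
    lt_or_lt_iff_ne, and_comm]

end SortedLists

/-! ### The action on a state with at most one factor of the given class. -/

section FormalSplit

variable {C : Type*} [DecidableEq C] (q : ℝ) (r : ℕ → ℝ)

theorem stepOn_of_notMem {c : C} {s : State C} (h : ∀ p ∈ s.2, p.1 ≠ c) :
    stepOn q r c s = Finsupp.single (s.create c) 1 := by
  rw [stepOn, Finset.sum_eq_zero fun k _ => if_neg (h _ (List.getElem_mem k.2)), add_zero]

theorem stepOn_of_split (c : C) (a : C → ℕ) (l₁ l₂ : List (C × ℕ)) (m : ℕ)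
    (h₁ : ∀ p ∈ l₁, p.1 ≠ c) (h₂ : ∀ p ∈ l₂, p.1 ≠ c) :
    stepOn q r c (a, l₁ ++ (c, m) :: l₂) =
      Finsupp.single (State.create (a, l₁ ++ (c, m) :: l₂) c) 1 +
        (q : ℂ) ^ l₁.length • ((r (m + 2) : ℂ) • Finsupp.single (a + Pi.single c 1, l₁ ++ l₂) 1 +
          Finsupp.single (a, (c, m + 1) :: (l₁ ++ l₂)) 1) := by
  have hlt : l₁.length < (l₁ ++ (c, m) :: l₂).length := by simp
  have hget : (l₁ ++ (c, m) :: l₂)[l₁.length] = (c, m) := by simp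
  have herase : (l₁ ++ (c, m) :: l₂).eraseIdx l₁.length = l₁ ++ l₂ := by
    simp [List.eraseIdx_append_of_length_le]
  rw [stepOn]
  congr 1
  rw [Finset.sum_eq_single (⟨l₁.length, hlt⟩ : Fin (l₁ ++ (c, m) :: l₂).length)]
  · simp only [Fin.getElem_fin, State.closeAt, State.raiseAt, hget, herase, if_true]
  · intro k _ hk
    refine if_neg ?_
    have hk' : (k : ℕ) ≠ l₁.length := fun h => hk (Fin.ext h)
    have hlen : (k : ℕ) < l₁.length + (l₂.length + 1) := by simpa using k.2
    simp only [Fin.getElem_fin]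
    rw [List.getElem_append]
    split_ifs with h
    · exact h₁ _ (List.getElem_mem _)
    · rw [List.getElem_cons, dif_neg (by omega)]
      exact h₂ _ (List.getElem_mem _)
  · exact fun h => absurd (Finset.mem_univ _) h

end FormalSplit

/-! ### Traces of the classes on the points `≥ k`, and restricted crossings. -/

section Traces

variable {n : ℕ} (π : SetPartition n)

/-- The trace of the class of `i` on the points `≥ k`. -/
def trace (k : ℕ) (i : Fin n) : Finset (Fin n) := (π.part i).filter fun j => k ≤ (j : ℕ)

/-- The first elements of the traces on the points `≥ k` of the classes outside `T`. -/
def traceMinima (T : Finset (Finset (Fin n))) (k : ℕ) : Finset (Fin n) :=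
  Finset.univ.filter fun i => k ≤ (i : ℕ) ∧ π.part i ∉ T ∧
    ∀ j ∈ π.part i, k ≤ (j : ℕ) → i ≤ j

theorem mem_traceMinima {T : Finset (Finset (Fin n))} {k : ℕ} {i : Fin n} :
    i ∈ traceMinima π T k ↔ k ≤ (i : ℕ) ∧ π.part i ∉ T ∧ ∀ j ∈ π.part i, k ≤ (j : ℕ) → i ≤ j := by
  simp [traceMinima]

/-- The classes contained in the set of the points `≥ k`. -/
def closable (k : ℕ) : Finset (Finset (Fin n)) :=
  π.parts.filter fun B => ∀ i ∈ B, k ≤ (i : ℕ)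

theorem mem_self (i : Fin n) : i ∈ π.part i := π.mem_part (Finset.mem_univ i)

theorem part_mem_parts (i : Fin n) : π.part i ∈ π.parts := π.part_mem.2 (Finset.mem_univ i)

theorem part_eq_of_mem_part {i j : Fin n} (h : j ∈ π.part i) : π.part j = π.part i :=
  π.part_eq_of_mem (part_mem_parts π i) h

theorem exists_traceMinima {T : Finset (Finset (Fin n))} {k : ℕ} {i : Fin n} (hi : k ≤ (i : ℕ))
    (hT : π.part i ∉ T) : ∃ j ∈ traceMinima π T k, π.part j = π.part i := by
  have hne : (trace π k i).Nonempty := ⟨i, Finset.mem_filter.2 ⟨mem_self π i, hi⟩⟩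
  obtain ⟨h1, h2⟩ := Finset.mem_filter.1 ((trace π k i).min'_mem hne)
  have h3 := part_eq_of_mem_part π h1
  refine ⟨(trace π k i).min' hne, (mem_traceMinima π).2 ⟨h2, h3 ▸ hT, fun j hj hk => ?_⟩, h3⟩
  exact Finset.min'_le (trace π k i) j (Finset.mem_filter.2 ⟨h3 ▸ hj, hk⟩)

theorem eq_of_mem_traceMinima {T : Finset (Finset (Fin n))} {k : ℕ} {i j : Fin n}
    (hi : i ∈ traceMinima π T k) (hj : j ∈ traceMinima π T k) (h : π.part i = π.part j) :
    i = j := by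
  obtain ⟨hi1, _, hi2⟩ := (mem_traceMinima π).1 hi
  obtain ⟨hj1, _, hj2⟩ := (mem_traceMinima π).1 hj
  exact le_antisymm (hi2 j (h ▸ mem_self π j) hj1) (hj2 i (h ▸ mem_self π i) hi1)

theorem part_notMem_closable (k : Fin n) : π.part k ∉ closable π (k + 1) := fun h => by
  have := (Finset.mem_filter.1 h).2 k (mem_self π k)
  omega

theorem closable_eq_of_forall {k : Fin n} (h : ∀ i ∈ π.part k, k ≤ i) :
    closable π k = insert (π.part k) (closable π (k + 1)) := by
  ext B
  simp only [closable, Finset.mem_insert, Finset.mem_filter]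
  constructor
  · rintro ⟨hB, h'⟩
    by_cases hk : k ∈ B
    · exact Or.inl (π.part_eq_of_mem hB hk).symm
    · refine Or.inr ⟨hB, fun i hi => Nat.succ_le_of_lt (lt_of_le_of_ne (h' i hi) fun e => hk ?_)⟩
      rwa [Fin.ext e]
  · rintro (rfl | ⟨hB, h'⟩)
    · exact ⟨part_mem_parts π k, h⟩
    · exact ⟨hB, fun i hi => (Nat.le_succ _).trans (h' i hi)⟩

theorem closable_eq_of_lt {k i : Fin n} (hi : i ∈ π.part k) (h : i < k) :
    closable π k = closable π (k + 1) := by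
  ext B
  simp only [closable, Finset.mem_filter]
  refine and_congr_right fun hB => ⟨fun h' j hj => ?_, fun h' j hj => (Nat.le_succ _).trans (h' j hj)⟩
  refine Nat.succ_le_of_lt (lt_of_le_of_ne (h' j hj) fun e => ?_)
  obtain rfl : k = j := Fin.ext e
  rw [π.part_eq_of_mem hB hj] at hi
  exact absurd (h' i hi) (not_le.2 h)

theorem trace_of_ne {k i : Fin n} (h : π.part i ≠ π.part k) : trace π k i = trace π (k + 1) i := by
  refine Finset.filter_congr fun j hj => ⟨fun h' => ?_, fun h' => (Nat.le_succ _).trans h'⟩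
  refine Nat.succ_le_of_lt (lt_of_le_of_ne h' fun e => h ?_)
  rw [Fin.ext e, part_eq_of_mem_part π hj]

theorem card_trace_self (k : Fin n) :
    (trace π k k).card = (trace π (k + 1) k).card + 1 := by
  have : trace π k k = insert k (trace π (k + 1) k) := by
    ext j
    simp only [trace, Finset.mem_insert, Finset.mem_filter]
    constructor
    · rintro ⟨h1, h2⟩
      rcases h2.eq_or_lt with e | h2
      · exact Or.inl (Fin.ext e.symm)
      · exact Or.inr ⟨h1, h2⟩
    · rintro (rfl | ⟨h1, h2⟩)
      · exact ⟨mem_self π j, le_rfl⟩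
      · exact ⟨h1, (Nat.le_succ _).trans h2⟩
  rw [this, Finset.card_insert_of_notMem fun h => by
    have := (Finset.mem_filter.1 h).2
    omega]

theorem trace_congr {k : ℕ} {i j : Fin n} (h : π.part i = π.part j) :
    trace π k i = trace π k j := by
  rw [trace, trace, h]

variable {T : Finset (Finset (Fin n))}

theorem mem_traceMinima_of_ne {k i : Fin n} (h : π.part i ≠ π.part k) :
    i ∈ traceMinima π T k ↔ i ∈ traceMinima π T (k + 1) := by
  have hne : ∀ j ∈ π.part i, (k : ℕ) ≤ j ↔ (k : ℕ) + 1 ≤ j := fun j hj =>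
    ⟨fun h' => Nat.succ_le_of_lt (lt_of_le_of_ne h' fun e => h (by
      rw [Fin.ext e, part_eq_of_mem_part π hj])), fun h' => (Nat.le_succ _).trans h'⟩
  rw [mem_traceMinima, mem_traceMinima, hne i (mem_self π i)]
  exact and_congr_right fun _ => and_congr_right fun _ => forall₂_congr fun j hj => by rw [hne j hj]

theorem self_mem_traceMinima {k : Fin n} (hT : π.part k ∉ T) : k ∈ traceMinima π T k :=
  (mem_traceMinima π).2 ⟨le_rfl, hT, fun _ _ h => h⟩

/-- The point `k` replaces the former first element of the trace of its class, and it precedes all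
the others: the combinatorial counterpart of moving a factor to the front. -/
theorem traceMinima_eq_insert {k : Fin n} (hT : π.part k ∉ T) :
    traceMinima π T k = insert k ((traceMinima π T (k + 1)).filter fun i => π.part i ≠ π.part k) := by
  ext i
  by_cases h : π.part i = π.part k
  · simp only [Finset.mem_insert, Finset.mem_filter, h, ne_eq, not_true_eq_false, and_false,
      or_false]
    refine ⟨fun hi => eq_of_mem_traceMinima π hi (self_mem_traceMinima π hT) h, ?_⟩
    rintro rfl
    exact self_mem_traceMinima π hT
  · have : i ≠ k := fun e => h (by rw [e])
    simp [mem_traceMinima_of_ne π h, h, this]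

theorem traceMinima_insert {k : Fin n} :
    traceMinima π (insert (π.part k) T) k =
      (traceMinima π T (k + 1)).filter fun i => π.part i ≠ π.part k := by
  ext i
  by_cases h : π.part i = π.part k
  · simp [mem_traceMinima, h]
  · have := mem_traceMinima_of_ne π (T := T) h
    rw [Finset.mem_filter, ← this, mem_traceMinima, mem_traceMinima, Finset.mem_insert, not_or]
    tauto

/-- The points of the class of `k` to the right of `k`. -/
def nextElems (k : Fin n) : Finset (Fin n) := (π.part k).filter fun i => k < i

theorem filter_of_nextElems_empty {k : Fin n} (h : ¬ (nextElems π k).Nonempty) :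
    ((traceMinima π T (k + 1)).filter fun i => π.part i ≠ π.part k) = traceMinima π T (k + 1) := by
  refine Finset.filter_true_of_mem fun i hi e => h ⟨i, Finset.mem_filter.2 ⟨e ▸ mem_self π i, ?_⟩⟩
  exact ((mem_traceMinima π).1 hi).1

theorem filter_of_nextElems_nonempty {k : Fin n} (h : (nextElems π k).Nonempty)
    (hT : π.part k ∉ T) :
    (nextElems π k).min' h ∈ traceMinima π T (k + 1) ∧
      ((traceMinima π T (k + 1)).filter fun i => π.part i ≠ π.part k) =
        (traceMinima π T (k + 1)).erase ((nextElems π k).min' h) := by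
  obtain ⟨h1, h2⟩ := Finset.mem_filter.1 ((nextElems π k).min'_mem h)
  have h3 := part_eq_of_mem_part π h1
  have hm : (nextElems π k).min' h ∈ traceMinima π T (k + 1) :=
    (mem_traceMinima π).2 ⟨h2, h3 ▸ hT, fun j hj hk =>
      Finset.min'_le (nextElems π k) j (Finset.mem_filter.2 ⟨h3 ▸ hj, Fin.lt_def.2 hk⟩)⟩
  refine ⟨hm, ?_⟩
  ext i
  rw [Finset.mem_filter, Finset.mem_erase, and_comm]
  refine and_congr_left fun hi => not_congr ⟨fun e => ?_, fun e => ?_⟩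
  · exact eq_of_mem_traceMinima π hi hm (e.trans h3.symm)
  · rw [e, h3]

/-- A class in `T` has no point `≤ k`, so the classes counted are those outside `T` that meet the
open interval. Each corresponds to the first element of its trace, which must lie before the next
element of the class of `k`. -/
theorem card_leftOpenBetween {k : Fin n} (h : (nextElems π k).Nonempty)
    (hT : T ⊆ closable π (k + 1)) :
    (leftOpenBetween (π.parts \ T) π k ((nextElems π k).min' h)).card =
      ((traceMinima π T (k + 1)).filter (· < (nextElems π k).min' h)).card := by
  set j := (nextElems π k).min' h with hj
  have hmem : ∀ i ∈ (traceMinima π T (k + 1)).filter (· < j), i ∈ π.part i ∩ Finset.Ioo k j := by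
    intro i hi
    obtain ⟨h1, h2⟩ := Finset.mem_filter.1 hi
    exact Finset.mem_inter.2 ⟨mem_self π i, Finset.mem_Ioo.2 ⟨((mem_traceMinima π).1 h1).1, h2⟩⟩
  have himage : leftOpenBetween (π.parts \ T) π k j =
      ((traceMinima π T (k + 1)).filter (· < j)).image fun i => π.part i ∩ Finset.Ioo k j := by
    ext X
    simp only [leftOpenBetween, Finset.mem_erase, Finset.mem_image, Finset.mem_filter,
      Finset.mem_sdiff]
    constructor
    · rintro ⟨hX, B, ⟨hB, hB'⟩, rfl⟩
      have hne := Finset.nonempty_iff_ne_empty.2 hX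
      obtain ⟨m1, m2⟩ := Finset.mem_inter.1 ((B ∩ Finset.Ioo k j).min'_mem hne)
      obtain ⟨m2, m3⟩ := Finset.mem_Ioo.1 m2
      have e := π.part_eq_of_mem hB m1
      refine ⟨(B ∩ Finset.Ioo k j).min' hne, ⟨(mem_traceMinima π).2 ⟨m2, ?_, ?_⟩, m3⟩, by rw [e]⟩
      · rw [e]
        rcases hB' with hB' | ⟨i, hi, hik⟩
        · exact hB'.2
        · intro hBT
          have := (Finset.mem_filter.1 (hT hBT)).2 i hi
          have : (i : ℕ) ≤ k := hik
          omega
      · intro i hi hki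
        rw [e] at hi
        rcases lt_or_ge i j with hij | hij
        · exact Finset.min'_le _ _ (Finset.mem_inter.2 ⟨hi, Finset.mem_Ioo.2 ⟨hki, hij⟩⟩)
        · exact m3.le.trans hij
    · rintro ⟨i, hi, rfl⟩
      refine ⟨Finset.ne_empty_of_mem (hmem i (Finset.mem_filter.2 hi)), π.part i,
        ⟨part_mem_parts π i, Or.inl ⟨part_mem_parts π i, ((mem_traceMinima π).1 hi.1).2.1⟩⟩, rfl⟩
  rw [himage, Finset.card_image_of_injOn]
  intro i hi i' hi' e
  have e : π.part i ∩ Finset.Ioo k j = π.part i' ∩ Finset.Ioo k j := e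
  have := hmem i hi
  rw [e] at this
  exact eq_of_mem_traceMinima π (Finset.mem_filter.1 hi).1 (Finset.mem_filter.1 hi').1
    (part_eq_of_mem_part π (Finset.mem_inter.1 this).1)

theorem rcAt_of_nonempty {k : Fin n} (h : (nextElems π k).Nonempty)
    (hT : T ⊆ closable π (k + 1)) :
    rcAt (π.parts \ T) π k =
      ((traceMinima π T (k + 1)).filter (· < (nextElems π k).min' h)).card := by
  rw [← card_leftOpenBetween π h hT]
  exact dif_pos h

theorem rcAt_of_empty {k : Fin n} (h : ¬ (nextElems π k).Nonempty)
    (S : Finset (Finset (Fin n))) : rcAt S π k = 0 := dif_neg h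

/-- The class of `k` has a point `≤ i`, so it is counted at `i` whether or not it belongs to `S`.
Closing a class at its first element thus leaves the earlier crossing counts intact. -/
theorem rcAt_insert {k i : Fin n} (hki : k ≤ i) :
    rcAt (π.parts \ insert (π.part k) T) π i = rcAt (π.parts \ T) π i := by
  have : ∀ j, leftOpenBetween (π.parts \ insert (π.part k) T) π i j =
      leftOpenBetween (π.parts \ T) π i j := by
    intro j
    rw [leftOpenBetween, leftOpenBetween]
    congr 2
    refine Finset.filter_congr fun B hB => ?_
    by_cases h : B = π.part k
    · have : ∃ x ∈ B, x ≤ i := ⟨k, h ▸ mem_self π k, hki⟩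
      simp [this]
    · simp [h]
  simp only [rcAt, this]

end Traces

/-! ### Weights of states. -/

section Weights

variable {C : Type*} [DecidableEq C]

theorem State.weight_pos_of_mem {s : State C} {c : C} (h : c ∈ s.2.map Prod.fst) :
    1 ≤ s.weight c :=
  le_add_left (Nat.succ_le_of_lt (List.count_pos_iff.2 h))

theorem State.weight_le_one {s : State C} {c : C} (h : (s.2.map Prod.fst).Nodup)
    (h1 : s.1 c ≤ 1) (h2 : c ∈ s.2.map Prod.fst → s.1 c = 0) : s.weight c ≤ 1 := by
  rw [State.weight]
  by_cases hc : c ∈ s.2.map Prod.fst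
  · rw [h2 hc, zero_add]
    exact List.nodup_iff_count_le_one.1 h c
  · rwa [List.count_eq_zero_of_not_mem hc, add_zero]

theorem State.weight_split (a : C → ℕ) (l₁ l₂ : List (C × ℕ)) (c : C) (m : ℕ) (d : C) :
    State.weight (a + Pi.single c 1, l₁ ++ l₂) d = State.weight (a, l₁ ++ (c, m) :: l₂) d := by
  simp only [State.weight, Pi.add_apply, Pi.single_apply, List.map_append, List.map_cons,
    List.count_append, List.count_cons, beq_iff_eq, eq_comm (a := d)]
  omega

end Weights

/-! ### The expansion into main states modulo negligible ones. -/

section Expansion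

variable {n : ℕ} (π : SetPartition n)

/-- The factor of the tensor product which belongs to the class of `i`, when the points `≥ k` have
been processed. -/
def traceEntry (k : ℕ) (i : Fin n) : π.parts × ℕ := (classOf π i, (trace π k i).card - 1)

/-- The state reached when the points `≥ k` have been processed and exactly the classes in `T` have
been closed. -/
def mainState (T : Finset (Finset (Fin n))) (k : ℕ) : State π.parts :=
  (fun c => if (c : Finset (Fin n)) ∈ T then 1 else 0,
    (traceMinima π T k).sort.map (traceEntry π k))

theorem weight_mainState_pos (T : Finset (Finset (Fin n))) {k : ℕ} {i : Fin n}
    (hi : k ≤ (i : ℕ)) : 1 ≤ (mainState π T k).weight (classOf π i) := by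
  by_cases hT : π.part i ∈ T
  · have : (mainState π T k).1 (classOf π i) = 1 := if_pos hT
    rw [State.weight, this]
    exact Nat.le_add_right _ _
  · obtain ⟨j, hj, e⟩ := exists_traceMinima π hi hT
    refine State.weight_pos_of_mem ?_
    rw [mainState, List.map_map]
    exact List.mem_map.2 ⟨j, (Finset.mem_sort _).2 hj, (classOf_eq_iff π).2 e⟩

theorem weight_mainState_le (T : Finset (Finset (Fin n))) (k : ℕ) (c : π.parts) :
    (mainState π T k).weight c ≤ 1 := by
  have hnodup : ((mainState π T k).2.map Prod.fst).Nodup := by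
    rw [mainState, List.map_map]
    refine List.Nodup.map_on (fun i hi j hj h => ?_) (Finset.sort_nodup _ _)
    exact eq_of_mem_traceMinima π ((Finset.mem_sort _).1 hi) ((Finset.mem_sort _).1 hj)
      ((classOf_eq_iff π).1 h)
  have h1 : (mainState π T k).1 c = if (c : Finset (Fin n)) ∈ T then 1 else 0 := rfl
  refine State.weight_le_one hnodup (by rw [h1]; split_ifs <;> omega) fun h => ?_
  rw [mainState, List.map_map] at h
  obtain ⟨i, hi, rfl⟩ := List.mem_map.1 h
  rw [h1]
  exact if_neg ((mem_traceMinima π).1 ((Finset.mem_sort _).1 hi)).2.1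

/-- The states without influence on the limit, when the points `≥ k` have been processed: some class
occurs twice, or has been closed although it has a point `< k`. -/
def negligible (k : ℕ) : Set (State π.parts) :=
  {s | (∀ i : Fin n, k ≤ (i : ℕ) → 1 ≤ s.weight (classOf π i)) ∧
    ((∃ c, 2 ≤ s.weight c) ∨ ∃ i : Fin n, (i : ℕ) < k ∧ 1 ≤ s.1 (classOf π i))}

theorem forall_weight_pos {k : Fin n} {s s' : State π.parts}
    (hs : ∀ i : Fin n, (k : ℕ) + 1 ≤ i → 1 ≤ s.weight (classOf π i))
    (hle : ∀ c, s.weight c ≤ s'.weight c) (hk : 1 ≤ s'.weight (classOf π k)) (i : Fin n)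
    (hi : (k : ℕ) ≤ i) : 1 ≤ s'.weight (classOf π i) := by
  rcases hi.eq_or_lt with e | hi
  · rwa [← Fin.ext e]
  · exact (hs i hi).trans (hle _)

/-- If the only defect was a class closed although it contains `k`, the new factor gives this class
weight at least 2; every other defect persists. -/
theorem create_mem_negligible {k : Fin n} {s : State π.parts} (hs : s ∈ negligible π (k + 1)) :
    s.create (classOf π k) ∈ negligible π k := by
  have hle : ∀ c, s.weight c ≤ (s.create (classOf π k)).weight c := fun c => by
    rw [State.weight_create]
    exact Nat.le_add_right _ _
  refine ⟨forall_weight_pos π hs.1 hle (by rw [State.weight_create, if_pos rfl]; omega), ?_⟩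
  rcases hs.2 with ⟨c, hc⟩ | ⟨i, hi, h1⟩
  · exact Or.inl ⟨c, hc.trans (hle c)⟩
  · rcases (Nat.lt_succ_iff.1 hi).eq_or_lt with e | hi
    · obtain rfl : i = k := Fin.ext e
      refine Or.inl ⟨classOf π i, ?_⟩
      rw [State.weight_create, if_pos rfl, State.weight]
      omega
    · exact Or.inr ⟨i, hi, h1⟩

/-- If the prematurely closed class is that of `k`, the factor being closed or raised exists beside
the recorded length, so the weight is already at least 2. -/
theorem mem_negligible_of_getElem {k : Fin n} {s s' : State π.parts}
    (hs : s ∈ negligible π (k + 1)) (hw : ∀ c, s'.weight c = s.weight c)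
    (h1 : ∀ c, s.1 c ≤ s'.1 c) {p : Fin s.2.length} (hp : s.2[p].1 = classOf π k) :
    s' ∈ negligible π k := by
  have hpos := s.weight_pos_of_getElem p
  rw [hp] at hpos
  refine ⟨forall_weight_pos π hs.1 (fun c => (hw c).ge) (by rw [hw]; omega), ?_⟩
  rcases hs.2 with ⟨c, hc⟩ | ⟨i, hi, h2⟩
  · exact Or.inl ⟨c, (hw c).symm ▸ hc⟩
  · rcases (Nat.lt_succ_iff.1 hi).eq_or_lt with e | hi
    · obtain rfl : i = k := Fin.ext e
      exact Or.inl ⟨classOf π i, by rw [hw]; omega⟩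
    · exact Or.inr ⟨i, hi, h2.trans (h1 _)⟩

variable (q : ℝ) (r : ℕ → ℝ)

theorem stepMap_mem_negligible {k : Fin n} {v : State π.parts →₀ ℂ}
    (hv : v ∈ Finsupp.supported ℂ ℂ (negligible π (k + 1))) :
    stepMap q r (classOf π k) v ∈ Finsupp.supported ℂ ℂ (negligible π k) := by
  rw [Finsupp.supported_eq_span_single] at hv
  induction hv using Submodule.span_induction with
  | mem v hv =>
    obtain ⟨s, hs, rfl⟩ := hv
    rw [stepMap_single, one_smul, stepOn]
    refine Submodule.add_mem _ (Finsupp.single_mem_supported _ _ (create_mem_negligible π hs))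
      (Submodule.sum_mem _ fun p _ => ?_)
    split_ifs with hp
    · refine Submodule.smul_mem _ _ (Submodule.add_mem _ (Submodule.smul_mem _ _ ?_) ?_)
      · exact Finsupp.single_mem_supported _ _ (mem_negligible_of_getElem π hs
          (s.weight_closeAt p) (fun c => Nat.le_add_right _ _) hp)
      · exact Finsupp.single_mem_supported _ _ (mem_negligible_of_getElem π hs
          (s.weight_raiseAt p) (fun c => le_rfl) hp)
    · exact Submodule.zero_mem _
  | zero => rw [map_zero]; exact Submodule.zero_mem _
  | add v w _ _ hv hw => rw [map_add]; exact Submodule.add_mem _ hv hw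
  | smul z v _ hv => rw [map_smul]; exact Submodule.smul_mem _ _ hv

/-- The coefficient of `mainState`. -/
def mainCoeff (T : Finset (Finset (Fin n))) (k : ℕ) : ℝ :=
  q ^ (∑ i ∈ Finset.univ.filter fun i : Fin n => k ≤ (i : ℕ), rcAt (π.parts \ T) π i) * ∏ B ∈ T, r B.card

theorem sum_filter_le (f : Fin n → ℕ) (k : Fin n) :
    ∑ i ∈ Finset.univ.filter (fun i : Fin n => (k : ℕ) ≤ i), f i =
      f k + ∑ i ∈ Finset.univ.filter (fun i : Fin n => (k : ℕ) + 1 ≤ i), f i := by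
  have : (Finset.univ.filter fun i : Fin n => (k : ℕ) ≤ i) =
      insert k (Finset.univ.filter fun i : Fin n => (k : ℕ) + 1 ≤ i) := by
    ext i
    simp only [Finset.mem_filter, Finset.mem_univ, true_and, Finset.mem_insert, Fin.ext_iff]
    omega
  rw [this, Finset.sum_insert (by simp)]

theorem mainCoeff_eq (T : Finset (Finset (Fin n))) (k : Fin n) :
    mainCoeff π q r T k = q ^ rcAt (π.parts \ T) π k * mainCoeff π q r T (k + 1) := by
  rw [mainCoeff, mainCoeff, sum_filter_le, pow_add, mul_assoc]

theorem mainCoeff_insert {T : Finset (Finset (Fin n))} {k : Fin n} (hT : π.part k ∉ T) :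
    mainCoeff π q r (insert (π.part k) T) k = r (π.part k).card * mainCoeff π q r T k := by
  have h : ∑ i ∈ Finset.univ.filter (fun i : Fin n => (k : ℕ) ≤ i),
      rcAt (π.parts \ insert (π.part k) T) π i =
      ∑ i ∈ Finset.univ.filter (fun i : Fin n => (k : ℕ) ≤ i), rcAt (π.parts \ T) π i :=
    Finset.sum_congr rfl fun i hi => rcAt_insert π (Finset.mem_filter.1 hi).2
  rw [mainCoeff, mainCoeff, Finset.prod_insert hT, h]
  ring

theorem traceEntry_of_ne {k i : Fin n} (h : π.part i ≠ π.part k) :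
    traceEntry π k i = traceEntry π (k + 1) i := by
  rw [traceEntry, traceEntry, trace_of_ne π h]

theorem mainState_eq_cons {T : Finset (Finset (Fin n))} {k : Fin n} (hT : π.part k ∉ T) :
    mainState π T k = (fun c : π.parts => if (c : Finset (Fin n)) ∈ T then 1 else 0,
      (classOf π k, (trace π (k + 1) k).card) ::
        ((traceMinima π T (k + 1)).filter fun i => π.part i ≠ π.part k).sort.map
          (traceEntry π (k + 1))) := by
  refine Prod.ext rfl ?_
  simp only [mainState]
  rw [traceMinima_eq_insert π hT, Finset.sort_insert, List.map_cons]
  · congr 1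
    · rw [traceEntry, card_trace_self, Nat.add_sub_cancel]
    · refine List.map_congr_left fun i hi => traceEntry_of_ne π ?_
      exact (Finset.mem_filter.1 ((Finset.mem_sort _).1 hi)).2
  · intro i hi
    have h := ((mem_traceMinima π).1 (Finset.mem_filter.1 hi).1).1
    exact Fin.le_def.2 ((Nat.le_succ _).trans h)
  · simp

theorem mainState_insert {T : Finset (Finset (Fin n))} {k : Fin n} (hT : π.part k ∉ T) :
    mainState π (insert (π.part k) T) k =
      ((fun c : π.parts => if (c : Finset (Fin n)) ∈ T then 1 else 0) + Pi.single (classOf π k) 1,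
        ((traceMinima π T (k + 1)).filter fun i => π.part i ≠ π.part k).sort.map
          (traceEntry π (k + 1))) := by
  refine Prod.ext ?_ ?_
  · funext c
    by_cases hc : c = classOf π k
    · subst hc
      have : ((classOf π k : π.parts) : Finset (Fin n)) = π.part k := rfl
      simp [mainState, this, hT]
    · have : (c : Finset (Fin n)) ≠ π.part k := fun h => hc (Subtype.ext h)
      simp [mainState, this, hc]
  · simp only [mainState]
    rw [traceMinima_insert]
    refine List.map_congr_left fun i hi => traceEntry_of_ne π ?_
    exact (Finset.mem_filter.1 ((Finset.mem_sort _).1 hi)).2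

/-- The processing of a point, up to negligible states. -/
theorem stepOn_mainState (hr : r 1 = 0) {k : Fin n} {T : Finset (Finset (Fin n))}
    (hT : T ⊆ closable π (k + 1)) :
    (mainCoeff π q r T (k + 1) : ℂ) • stepOn q r (classOf π k) (mainState π T (k + 1)) -
      (Finsupp.single (mainState π T k) (mainCoeff π q r T k : ℂ) +
        if ∀ i ∈ π.part k, k ≤ i then
          Finsupp.single (mainState π (insert (π.part k) T) k)
            (mainCoeff π q r (insert (π.part k) T) k : ℂ) else 0) ∈
      Finsupp.supported ℂ ℂ (negligible π k) := by
  have hkT : π.part k ∉ T := fun h => part_notMem_closable π k (hT h)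
  by_cases hne : (nextElems π k).Nonempty
  · set j := (nextElems π k).min' hne with hj
    obtain ⟨hjM, hfil⟩ := filter_of_nextElems_nonempty π hne hkT
    rw [← hj] at hjM hfil
    obtain ⟨hjk, hkj⟩ := Finset.mem_filter.1 ((nextElems π k).min'_mem hne)
    have hpart : π.part j = π.part k := part_eq_of_mem_part π hjk
    set a : π.parts → ℕ := fun c => if (c : Finset (Fin n)) ∈ T then 1 else 0 with ha
    set l₁ := ((traceMinima π T (k + 1)).filter (· < j)).sort.map (traceEntry π (k + 1)) with hl₁
    set l₂ := ((traceMinima π T (k + 1)).filter (j < ·)).sort.map (traceEntry π (k + 1)) with hl₂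
    have hcard : 1 ≤ (trace π (k + 1) k).card :=
      Finset.card_pos.2 ⟨j, Finset.mem_filter.2 ⟨hjk, hkj⟩⟩
    set m := (trace π (k + 1) k).card - 1 with hm
    have hsplit : mainState π T (k + 1) = (a, l₁ ++ (classOf π k, m) :: l₂) := by
      refine Prod.ext rfl ?_
      simp only [mainState]
      rw [sort_eq_append _ hjM, List.map_append, List.map_cons]
      congr 2
      rw [traceEntry, trace_congr π hpart, (classOf_eq_iff π).2 hpart]
    have hneq : ∀ i ∈ traceMinima π T (k + 1), i ≠ j → (traceEntry π (k + 1) i).1 ≠ classOf π k :=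
      fun i hi hij h => hij (eq_of_mem_traceMinima π hi hjM
        (((classOf_eq_iff π).1 h).trans hpart.symm))
    have h₁ : ∀ p ∈ l₁, p.1 ≠ classOf π k := by
      intro p hp
      obtain ⟨i, hi, rfl⟩ := List.mem_map.1 hp
      obtain ⟨hi, hij⟩ := Finset.mem_filter.1 ((Finset.mem_sort _).1 hi)
      exact hneq i hi hij.ne
    have h₂ : ∀ p ∈ l₂, p.1 ≠ classOf π k := by
      intro p hp
      obtain ⟨i, hi, rfl⟩ := List.mem_map.1 hp
      obtain ⟨hi, hij⟩ := Finset.mem_filter.1 ((Finset.mem_sort _).1 hi)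
      exact hneq i hi hij.ne'
    have hlist : ((traceMinima π T (k + 1)).filter fun i => π.part i ≠ π.part k).sort.map
        (traceEntry π (k + 1)) = l₁ ++ l₂ := by
      rw [hfil, sort_erase_eq_append, List.map_append]
    have hraise : mainState π T k = (a, (classOf π k, m + 1) :: (l₁ ++ l₂)) := by
      rw [mainState_eq_cons π hkT, hlist, hm, Nat.sub_add_cancel hcard]
    have hclose : mainState π (insert (π.part k) T) k =
        (a + Pi.single (classOf π k) 1, l₁ ++ l₂) := by
      rw [mainState_insert π hkT, hlist]
    have hlen : l₁.length = rcAt (π.parts \ T) π k := by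
      rw [rcAt_of_nonempty π hne hT, hl₁, List.length_map, Finset.length_sort]
    have hpos : ∀ i : Fin n, (k : ℕ) + 1 ≤ i →
        1 ≤ State.weight (a, l₁ ++ (classOf π k, m) :: l₂) (classOf π i) := fun i hi =>
      hsplit ▸ weight_mainState_pos π T hi
    have hposk : 1 ≤ State.weight (a, l₁ ++ (classOf π k, m) :: l₂) (classOf π k) := by
      have := hpos j hkj
      rwa [(classOf_eq_iff π).2 hpart] at this
    -- Creating a second factor of a class that already has one produces weight 2.
    have hcreate : State.create (a, l₁ ++ (classOf π k, m) :: l₂) (classOf π k) ∈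
        negligible π k := by
      refine ⟨forall_weight_pos π hpos (fun c => ?_) ?_, Or.inl ⟨classOf π k, ?_⟩⟩
      · rw [State.weight_create]
        exact Nat.le_add_right _ _
      · rw [State.weight_create]
        omega
      · rw [State.weight_create, if_pos rfl]
        omega
    -- Closing the class before its first element is reached falls under the second alternative of
    -- `negligible`.
    have hpremature : (¬ ∀ i ∈ π.part k, k ≤ i) →
        ((a + Pi.single (classOf π k) 1, l₁ ++ l₂) : State π.parts) ∈ negligible π k := by
      intro h
      push Not at h
      obtain ⟨i, hi, hik⟩ := h
      have hw : ∀ c, State.weight (a + Pi.single (classOf π k) 1, l₁ ++ l₂) c =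
          State.weight (a, l₁ ++ (classOf π k, m) :: l₂) c :=
        State.weight_split a l₁ l₂ _ m
      refine ⟨forall_weight_pos π hpos (fun c => (hw c).ge) (by rw [hw]; exact hposk),
        Or.inr ⟨i, hik, ?_⟩⟩
      rw [(classOf_eq_iff π).2 (part_eq_of_mem_part π hi)]
      simp
    rw [mainCoeff_insert π q r hkT, hsplit, stepOn_of_split q r _ _ _ _ _ h₁ h₂, hlen, hraise,
      hclose, mainCoeff_eq]
    -- The raising term cancels the main state in which the class stays open; the created term and
    -- the closing term remain.
    have hreg : ∀ (x y z : State π.parts →₀ ℂ) (α β γ : ℂ) (w w' : State π.parts →₀ ℂ),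
        w = (α * β) • z → α • (x + β • (γ • y + z)) - (w + w') =
          α • x + ((α * β * γ) • y - w') := by
      rintro x y z α β γ _ w' rfl
      module
    rw [hreg]
    · refine Submodule.add_mem _
        (Submodule.smul_mem _ _ (Finsupp.single_mem_supported _ _ hcreate)) ?_
      split_ifs with hall
      · have htr : trace π k k = π.part k :=
          Finset.filter_true_of_mem fun i hi => Fin.le_def.1 (hall i hi)
        have hB : (π.part k).card = m + 2 := by
          rw [← htr, card_trace_self]
          omega
        rw [hB, Finsupp.smul_single, smul_eq_mul, mul_one]
        convert Submodule.zero_mem _ using 1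
        rw [sub_eq_zero]
        congr 1
        push_cast
        ring
      · rw [sub_zero]
        exact Submodule.smul_mem _ _ (Finsupp.single_mem_supported _ _ (hpremature hall))
    · rw [Finsupp.smul_single, smul_eq_mul, mul_one]
      congr 1
      push_cast
      ring
  · have hfil := filter_of_nextElems_empty π (T := T) hne
    have hnot : ∀ p ∈ (mainState π T (k + 1)).2, p.1 ≠ classOf π k := by
      intro p hp
      simp only [mainState] at hp
      obtain ⟨i, hi, rfl⟩ := List.mem_map.1 hp
      rw [Finset.mem_sort, ← hfil] at hi
      exact fun h => (Finset.mem_filter.1 hi).2 ((classOf_eq_iff π).1 h)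
    have htr : trace π (k + 1) k = ∅ := Finset.not_nonempty_iff_eq_empty.1 hne
    have hcreate : (mainState π T (k + 1)).create (classOf π k) = mainState π T k := by
      rw [mainState_eq_cons π hkT, hfil, htr]
      rfl
    -- Here the class of `k` has no later point, so there is no factor to close. If `k` is also its
    -- first point, the class is a singleton and the closed term has coefficient `r 1 = 0`.
    have hzero : (if ∀ i ∈ π.part k, k ≤ i then
        Finsupp.single (mainState π (insert (π.part k) T) k)
          (mainCoeff π q r (insert (π.part k) T) k : ℂ) else 0) = 0 := by
      split_ifs with hall
      · have htr' : trace π k k = π.part k :=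
          Finset.filter_true_of_mem fun i hi => Fin.le_def.1 (hall i hi)
        rw [mainCoeff_insert π q r hkT, ← htr', card_trace_self, htr, Finset.card_empty, zero_add,
          hr, zero_mul, Complex.ofReal_zero, Finsupp.single_zero]
      · rfl
    rw [hzero, add_zero, stepOn_of_notMem q r hnot, hcreate, mainCoeff_eq, rcAt_of_empty π hne,
      pow_zero, one_mul, Finsupp.smul_single, smul_eq_mul, mul_one, sub_self]
    exact Submodule.zero_mem _

/-- The combination of the main states when the points `≥ k` have been processed. -/
def mainSum (k : ℕ) : State π.parts →₀ ℂ :=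
  ∑ T ∈ (closable π k).powerset, Finsupp.single (mainState π T k) (mainCoeff π q r T k : ℂ)

/-- The class of `k` becomes closable exactly when `k` is its first point; the subsets `T` then
split according to whether they contain it. -/
theorem mainSum_eq (k : Fin n) :
    mainSum π q r k = ∑ T ∈ (closable π (k + 1)).powerset,
      (Finsupp.single (mainState π T k) (mainCoeff π q r T k : ℂ) +
        if ∀ i ∈ π.part k, k ≤ i then
          Finsupp.single (mainState π (insert (π.part k) T) k)
            (mainCoeff π q r (insert (π.part k) T) k : ℂ) else 0) := by
  rw [mainSum, Finset.sum_add_distrib]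
  by_cases h : ∀ i ∈ π.part k, k ≤ i
  · simp only [if_pos h]
    rw [closable_eq_of_forall π h, Finset.sum_powerset_insert (part_notMem_closable π k)]
  · simp only [if_neg h, Finset.sum_const_zero, add_zero]
    push Not at h
    obtain ⟨i, hi, hik⟩ := h
    rw [closable_eq_of_lt π hi hik]

theorem formalProd_sub_mainSum_mem (hr : r 1 = 0) {k : ℕ} (hk : k ≤ n) :
    formalProd q r ((List.ofFn (classOf π)).drop k) - mainSum π q r k ∈
      Finsupp.supported ℂ ℂ (negligible π k) := by
  induction hk using Nat.decreasingInduction with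
  | self =>
    have h1 : closable π n = ∅ := Finset.filter_false_of_mem fun B hB h => by
      obtain ⟨i, hi⟩ := π.nonempty_of_mem_parts hB
      exact absurd i.2 (not_lt.2 (h i hi))
    have h2 : traceMinima π ∅ n = ∅ := Finset.filter_false_of_mem fun i _ h =>
      absurd i.2 (not_lt.2 h.1)
    have h3 : (Finset.univ.filter fun i : Fin n => n ≤ (i : ℕ)) = ∅ :=
      Finset.filter_false_of_mem fun i _ h => absurd i.2 (not_lt.2 h)
    have h4 : mainState π ∅ n = (0, []) := by
      rw [mainState, h2]
      simp
      rfl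
    rw [List.drop_of_length_le (by simp), mainSum, h1, Finset.powerset_empty,
      Finset.sum_singleton, h4, mainCoeff, h3]
    simp [formalProd]
  | of_succ k hk ih =>
    let i : Fin n := ⟨k, hk⟩
    have hdrop : (List.ofFn (classOf π)).drop k =
        classOf π i :: (List.ofFn (classOf π)).drop (k + 1) := by
      rw [List.drop_eq_getElem_cons (by simpa using hk), List.getElem_ofFn]
    have hprod : formalProd q r ((List.ofFn (classOf π)).drop k) =
        stepMap q r (classOf π i) (formalProd q r ((List.ofFn (classOf π)).drop (k + 1))) := by
      rw [hdrop]
      rfl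
    have h1 := stepMap_mem_negligible π q r (k := i) ih
    have h2 : stepMap q r (classOf π i) (mainSum π q r (k + 1)) - mainSum π q r k ∈
        Finsupp.supported ℂ ℂ (negligible π k) := by
      have := mainSum_eq π q r i
      rw [show ((i : Fin n) : ℕ) = k from rfl] at this
      rw [this, mainSum, map_sum, ← Finset.sum_sub_distrib]
      refine Submodule.sum_mem _ fun T hT => ?_
      rw [stepMap_single]
      exact stepOn_mainState π q r hr (k := i) (Finset.mem_powerset.1 hT)
    rw [map_sub, ← hprod] at h1
    have := Submodule.add_mem _ h1 h2
    rwa [sub_add_sub_cancel] at this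

end Expansion

/-! ### Evaluation of the limit at `k = 0`. -/

section Conclusion

variable (q : Set.Ioo (-1 : ℝ) 1) (ν : Measure ℝ) {n : ℕ} (π : SetPartition n)

theorem closable_zero : closable π 0 = π.parts :=
  Finset.filter_true_of_mem fun _ _ _ _ => Nat.zero_le _

theorem openMinima_eq {T : Finset (Finset (Fin n))} :
    openMinima (π.parts \ T) π = traceMinima π T 0 :=
  Finset.filter_congr fun i _ => by
    simp [Finset.mem_sdiff, part_mem_parts π i]

theorem prod_closedCount {T : Finset (Finset (Fin n))} (hT : T ⊆ π.parts) (t : ℝ) :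
    ∏ c : π.parts, t ^ (if (c : Finset (Fin n)) ∈ T then 1 else 0) = t ^ T.card := by
  rw [Finset.prod_coe_sort π.parts fun B => t ^ (if B ∈ T then 1 else 0),
    Finset.prod_pow_eq_pow_sum, Finset.sum_ite_mem, Finset.inter_eq_right.2 hT, Finset.sum_const]
  simp

theorem mainCoeff_zero {T : Finset (Finset (Fin n))} (hT : T ⊆ π.parts) (t : ℝ) :
    mainCoeff π q (levyMoment ν) T 0 * t ^ T.card =
      (q : ℝ) ^ rc (π.parts \ T) π * closedWeight (π.parts \ T) π ν t := by
  have : (Finset.univ.filter fun i : Fin n => 0 ≤ (i : ℕ)) = Finset.univ :=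
    Finset.filter_true_of_mem fun _ _ => Nat.zero_le _
  rw [mainCoeff, this, closedWeight, Finset.sdiff_sdiff_eq_self hT, rc]
  ring

theorem weight_pos_of_forall {s : State π.parts}
    (h : ∀ i : Fin n, 0 ≤ (i : ℕ) → 1 ≤ s.weight (classOf π i)) (c : π.parts) :
    1 ≤ s.weight c := by
  obtain ⟨i, rfl⟩ := exists_classOf π c
  exact h i (Nat.zero_le _)

theorem formalProd_sub_mainSum_zero_mem :
    formalProd q (levyMoment ν) (List.ofFn (classOf π)) - mainSum π q (levyMoment ν) 0 ∈
      Finsupp.supported ℂ ℂ (negligible π 0) :=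
  formalProd_sub_mainSum_mem π q (levyMoment ν) rfl (Nat.zero_le n)

theorem formalProd_mem_supported :
    formalProd q (levyMoment ν) (List.ofFn (classOf π)) ∈
      Finsupp.supported ℂ ℂ {s : State π.parts | ∀ c, 1 ≤ s.weight c} := by
  rw [← sub_add_cancel (formalProd _ _ _) (mainSum π q (levyMoment ν) 0)]
  refine Submodule.add_mem _ (Finsupp.supported_mono (fun s hs => weight_pos_of_forall π hs.1)
    (formalProd_sub_mainSum_zero_mem q ν π)) (Submodule.sum_mem _ fun T _ => ?_)
  exact Finsupp.single_mem_supported _ _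
    (weight_pos_of_forall π fun i => weight_mainState_pos π T)

variable [IsFiniteMeasure ν] (hν : IsCompact ν.support)

theorem boxVec_openSizes (T : Finset (Finset (Fin n))) (t : ℝ) :
    boxVec q ν hν (fun i => openSizes (π.parts \ T) π i - 1) (fun _ => 0) (fun _ => t) =
      ((listVec q ((mainState π T 0).2.map fun p => incrVec ν hν p.2 0 t) :
        FockAlg q (OneParticle ν)) : FockSpace q (OneParticle ν)) := by
  have h : ∀ M : Finset (Fin n), List.ofFn (fun i : Fin M.card =>
      incrVec ν hν ((π.part (M.orderEmbOfFin rfl i)).card - 1) 0 t) =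
      (M.sort.map (traceEntry π 0)).map fun p => incrVec ν hν p.2 0 t := by
    intro M
    rw [← Finset.listMap_orderEmbOfFin_finRange M rfl, List.map_map, List.map_map, List.ofFn_eq_map]
    refine List.map_congr_left fun i _ => ?_
    simp [traceEntry, trace]
  rw [boxVec, incl_tprod]
  simp only [openSizes]
  rw [h, openMinima_eq]
  rfl

theorem stateLimit_mainState {T : Finset (Finset (Fin n))} (hT : T ⊆ π.parts) {t : ℝ}
    (ht : 0 ≤ t) : stateLimit q ν hν t (mainState π T 0) =
      ((t ^ T.card : ℝ) : ℂ) • fullMeasure q ν hν (openSizes (π.parts \ T) π) t := by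
  rw [fullMeasure_eq q ν hν _ ht, boxVec_openSizes, stateLimit]
  congr 2
  rw [← prod_closedCount π hT]
  refine Finset.prod_congr rfl fun c _ => if_pos (le_antisymm (weight_mainState_le π T 0 c) ?_)
  obtain ⟨i, rfl⟩ := exists_classOf π c
  exact weight_mainState_pos π T (Nat.zero_le _)

/-- No point lies before `0`, so a negligible state has a class of weight at least 2, and a factor
of its limit vanishes. -/
theorem linearCombination_stateLimit_negligible (t : ℝ) {v : State π.parts →₀ ℂ}
    (hv : v ∈ Finsupp.supported ℂ ℂ (negligible π 0)) :
    Finsupp.linearCombination ℂ (stateLimit q ν hν t) v = 0 := by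
  rw [Finsupp.linearCombination_apply]
  refine Finset.sum_eq_zero fun s hs => ?_
  obtain ⟨_, ⟨c, hc⟩ | ⟨i, hi, _⟩⟩ := (Finsupp.mem_supported ℂ v).1 hv hs
  · have : s.weight c ≠ 1 := by omega
    simp only [stateLimit]
    rw [Finset.prod_eq_zero (Finset.mem_univ c) (if_neg this)]
    simp
  · exact absurd hi (Nat.not_lt_zero _)

theorem linearCombination_stateLimit_formalProd {t : ℝ} (ht : 0 ≤ t) :
    Finsupp.linearCombination ℂ (stateLimit q ν hν t)
      (formalProd q (levyMoment ν) (List.ofFn (classOf π))) =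
      ∑ S ∈ π.parts.powerset, ((((q : ℝ) ^ rc S π * closedWeight S π ν t : ℝ)) : ℂ) •
        fullMeasure q ν hν (openSizes S π) t := by
  rw [← sub_add_cancel (formalProd _ _ _) (mainSum π q (levyMoment ν) 0), map_add,
    linearCombination_stateLimit_negligible q ν π hν t (formalProd_sub_mainSum_zero_mem q ν π),
    zero_add, mainSum, map_sum, closable_zero]
  -- The closed classes `T` are the complement of the open classes `S` of the formula.
  refine Finset.sum_bij' (fun T _ => π.parts \ T) (fun S _ => π.parts \ S)
    (fun T _ => Finset.mem_powerset.2 Finset.sdiff_subset)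
    (fun S _ => Finset.mem_powerset.2 Finset.sdiff_subset)
    (fun T hT => Finset.sdiff_sdiff_eq_self (Finset.mem_powerset.1 hT))
    (fun S hS => Finset.sdiff_sdiff_eq_self (Finset.mem_powerset.1 hS)) fun T hT => ?_
  have hT := Finset.mem_powerset.1 hT
  rw [Finsupp.linearCombination_single, stateLimit_mainState q ν π hν hT ht, smul_smul,
    ← Complex.ofReal_mul, mainCoeff_zero q ν π hT]

end Conclusion

end

end QLevy

theorem mainTheorem5 (q : Set.Ioo (-1 : ℝ) 1) (ν : MeasureTheory.Measure ℝ)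
    [MeasureTheory.IsFiniteMeasure ν] (hν : IsCompact ν.support) (n : ℕ)
    (π : QLevy.SetPartition n) (t : ℝ) (ht : 0 ≤ t) :
    (∀ S ⊆ π.parts, ∃! v, QLevy.IsMultipleIntegral q ν hν (QLevy.openSizes S π)
      (QLevy.boxIndicator (fun _ => 0) fun _ => t) v) ∧
    ∃ St ∈ QLevy.levyL2 q ν hν,
      QLevy.IsStochasticMeasure q ν hν π t St ∧
      (∀ v, QLevy.IsStochasticMeasure q ν hν π t v → v = St) ∧
      St = ∑ S ∈ π.parts.powerset,
        ((((q : ℝ) ^ QLevy.rc S π * QLevy.closedWeight S π ν t : ℝ)) : ℂ) •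
          QLevy.fullMeasure q ν hν (QLevy.openSizes S π) t := by
  have := QLevy.meshFilter_neBot ht
  have h := QLevy.isStochasticMeasure_of_supported q ν hν π (t := t)
    (QLevy.formalProd_mem_supported q ν π)
  refine ⟨fun S _ => QLevy.existsUnique_isMultipleIntegral q ν hν _ ht, _, ?_, h,
    fun v hv => tendsto_nhds_unique hv h,
    QLevy.linearCombination_stateLimit_formalProd q ν π hν ht⟩
  -- The approximating vectors come from the algebra generated by the increments of `X`, and its
  -- closure contains their limit.
  exact (Submodule.isClosed_topologicalClosure _).mem_of_tendsto h
    (Filter.Eventually.of_forall (QLevy.applyVacuum_stSum_mem q ν hν π))
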